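/- A plane increasing tree on $[n]=\{1,\dots,n\}$ is a rooted plane tree (the children of every vertex are linearly ordered) whose vertices are bijectively labelled by $[n]$ so that every non-root vertex has a larger label than its parent. The rank of a vertex $v$ is the number of edges in a shortest path from $v$ to a leaf that is a descendant of $v$. For $k\ge 0$ let $b_k(n)$ be the number of plane increasing trees on $[n]$ whose root has rank $k$, and put $$B_k(z)=\sum_{n\ge 1} b_k(n)\frac{z^n}{n!}\quad (|z|<1/2),\qquad c_k=2\int_0^{1/2}\sqrt{1-2\xi}\,B_k'(\xi)\,d\xi .$$ Then $c_k>0$ for all $k\ge 0$ and $\sum_{k\ge 0}c_k=1$. Let $r\ge 1$. For $n\ge r$, choose a plane increasing tree on $[n]$ uniformly at random and, independently of it, $r$ vertices uniformly at random from $[n]$, in order and without replacement; let $R_n(1),\dots,R_n(r)$ be their ranks. Then, for every fixed $(k_1,\dots,k_r)$ of non-negative integers, $$\mathbb{P}\bigl(R_n(1)=k_1,\dots,R_n(r)=k_r\bigr)=\bigl(1+O(n^{-1})\bigr)\prod_{j=1}^r c_{k_j},$$ where the constant implied by $O$ may depend on $r$ and $(k_1,\dots,k_r)$ but not on $n\ge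 r$. Thus the ranks are asymptotically independent, each with law $\{c_k\}_{k\ge 0}$: for every set $S$ of $r$-tuples of non-negative integers, $$\lim_{n\to\infty}\mathbb{P}\bigl((R_n(1),\dots,R_n(r))\in S\bigr)=\sum_{(k_1,\dots,k_r)\in S}\ \prod_{j=1}^r c_{k_j}.$$ -/

import Mathlib

open Filter Topology

/-- Rooted plane trees whose vertices carry natural number labels: a tree is a root label
together with the (possibly empty) ordered list of the subtrees hanging from the root. -/
inductive PlaneTree : Type
  | node (label : ℕ) (children : List PlaneTree) : PlaneTree

namespace PlaneTree

/-- The label of the root. -/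
def label : PlaneTree → ℕ
  | node a _ => a

/-- The ordered list of subtrees rooted at the children of the root. -/
def children : PlaneTree → List PlaneTree
  | node _ cs => cs

/-- The list of all descendant subtrees, one for each vertex of the tree (in preorder):
the entry for a vertex `v` consists of `v` and all its descendants. -/
def subtrees : PlaneTree → List PlaneTree
  | node a cs => node a cs :: (cs.map subtrees).flatten

/-- The labels of all vertices, listed in preorder. -/
def labels (t : PlaneTree) : List ℕ :=
  t.subtrees.map label

/-- Some leaf of the tree is at distance exactly `d` (number of edges) from the root. -/
inductive HasLeafAtDepth : PlaneTree → ℕ → Prop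
  | leaf (a : ℕ) : HasLeafAtDepth (node a []) 0
  | step (a : ℕ) (cs : List PlaneTree) (s : PlaneTree) (d : ℕ) :
      s ∈ cs → HasLeafAtDepth s d → HasLeafAtDepth (node a cs) (d + 1)

/-- The rank of the root: the number of edges in a shortest path from the root to a leaf. -/
noncomputable def rootRank (t : PlaneTree) : ℕ :=
  sInf {d : ℕ | t.HasLeafAtDepth d}

/-- The rank of the vertex labelled `v`: the number of edges in a shortest path from `v` to a
leaf which is a descendant of `v`. -/
noncomputable def vertexRank (t : PlaneTree) (v : ℕ) : ℕ :=
  sInf {k : ℕ | ∃ s ∈ t.subtrees, s.label = v ∧ s.rootRank = k}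

end PlaneTree

/-- The plane increasing trees with label set `S`: every element of `S` is the label of exactly
one vertex, no other labels occur, and every vertex has a larger label than its parent. -/
def increasingTrees (S : Finset ℕ) : Set PlaneTree :=
  {t | t.labels.Nodup ∧ (∀ a, a ∈ t.labels ↔ a ∈ S) ∧
    ∀ s ∈ t.subtrees, ∀ u ∈ s.children, s.label < u.label}

/-- The number of plane increasing trees on `{1, …, n}` whose root has rank `k`. -/
noncomputable def rootRankCount (k n : ℕ) : ℕ :=
  {t | t ∈ increasingTrees (Finset.Icc 1 n) ∧ t.rootRank = k}.ncard

/-- The exponential generating function of `rootRankCount k`, for real `|z| < 1 / 2`. -/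
noncomputable def rootRankEGF (k : ℕ) (z : ℝ) : ℝ :=
  ∑' n : ℕ, (rootRankCount k n : ℝ) * z ^ n / (n.factorial : ℝ)

/-- The constants `c_k = 2 ∫₀^{1/2} √(1 - 2ξ) B_k'(ξ) dξ`, where `B_k` is `rootRankEGF k`. -/
noncomputable def rankLimit (k : ℕ) : ℝ :=
  2 * ∫ ξ in (0 : ℝ)..(1 / 2), √(1 - 2 * ξ) * deriv (rootRankEGF k) ξ

/-- The equally likely outcomes of the experiment: a plane increasing tree on `{1, …, n}` and
an ordered `r`-tuple of distinct vertices. -/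
def rankSamples (r n : ℕ) : Set (PlaneTree × (Fin r → ℕ)) :=
  {ω | ω.1 ∈ increasingTrees (Finset.Icc 1 n) ∧
    Function.Injective ω.2 ∧ ∀ j, ω.2 j ∈ Finset.Icc 1 n}

/-- The probability that the tuple of ranks `(R_n(1), …, R_n(r))` lies in `S`, when the tree and
the ordered `r`-tuple of distinct vertices are chosen uniformly at random. -/
noncomputable def rankProb (r n : ℕ) (S : Set (Fin r → ℕ)) : ℝ :=
  ({ω | ω ∈ rankSamples r n ∧ (fun j => ω.1.vertexRank (ω.2 j)) ∈ S}.ncard : ℝ) /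
    ((rankSamples r n).ncard : ℝ)

/-! Splitting off the first root branch writes every tree with more than one vertex uniquely as
`graft L R`, where `R` keeps the root and the remaining branches. The root has the smallest label
and the other labels are shared out freely between `L` and `R`. For a statistic that depends only on
the shape and splits along grafting into products, this gives a differential equation for its
exponential generating function (`derivative_treeSeries`). For the counting series it reads T' = 1 +
T T', so (1 - T)² = 1 - 2X and T' = (1 - 2X)^(-1/2).

Let N_k be the number of vertices of rank k. Its non-root part is additive under grafting, up to a
root indicator in `L`. The resulting linear recurrence telescopes, and the mean of N_k is ρ_k n +
O(1), where ρ_k is a convergent series in the root-rank probabilities (`abs_treeSum_deviation_le`).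
A Beta integral, applied term by term, identifies ρ_k with c_k (`rankLimit_eq`).

The same equation for squares contains a cross term, which the O(1) bias controls. The remaining
recurrence shows that the second moment of N_k - ρ_k n is O(n) (`exists_treeSum_deviation_sq_le`).

Given the tree, sampling with replacement produces the ranks k_1, …, k_r with probability ∏
N_{k_j}/n. In the expansion of this product around ∏ ρ_{k_j}, the linear terms have mean O(1/n) by
the bias bound, and the quadratic ones by the variance bound. Avoiding repeated vertices costs
another O(1/n), and since ρ_k > 0 the absolute error is a relative one. As the limits sum to 1, no
mass escapes, so pointwise convergence extends to all events (`tendsto_prob_of_tendsto_singleton`).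
-/

namespace PlaneTree

/-! ### Splitting off the first root branch. -/

/-- Induction along the decomposition of a tree into its first root branch and the rest. -/
theorem graft_induction {P : PlaneTree → Prop} (hleaf : ∀ a, P (node a []))
    (hgraft : ∀ L a cs, P L → P (node a cs) → P (node a (L :: cs))) : ∀ t, P t
  | node a [] => hleaf a
  | node a (L :: cs) =>
      hgraft L a cs (graft_induction hleaf hgraft L) (graft_induction hleaf hgraft (node a cs))
termination_by t => sizeOf t

/-- Attach `L` as a new first branch to the root of `R`. -/
def graft (L R : PlaneTree) : PlaneTree :=
  node R.label (L :: R.children)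

theorem graft_inj {L R L' R' : PlaneTree} (h : graft L R = graft L' R') : L = L' ∧ R = R' := by
  cases R; cases R'
  simp_all [graft, label, children]

/-- The subtrees of the non-root vertices. -/
def properSubtrees (t : PlaneTree) : List PlaneTree :=
  (t.children.map subtrees).flatten

theorem subtrees_eq (t : PlaneTree) : t.subtrees = t :: t.properSubtrees := by
  cases t
  rw [subtrees, properSubtrees, children]

theorem properSubtrees_leaf (a : ℕ) : (node a []).properSubtrees = [] := rfl

theorem properSubtrees_graft (L R : PlaneTree) :
    (graft L R).properSubtrees = L.subtrees ++ R.properSubtrees := by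
  simp [properSubtrees, graft, children]

theorem node_cons (a : ℕ) (L : PlaneTree) (cs : List PlaneTree) :
    node a (L :: cs) = graft L (node a cs) := rfl

theorem label_graft (L R : PlaneTree) : (graft L R).label = R.label := rfl

theorem labels_eq (t : PlaneTree) : t.labels = t.label :: t.properSubtrees.map label := by
  rw [labels, subtrees_eq, List.map_cons]

theorem labels_graft (L R : PlaneTree) :
    (graft L R).labels = R.label :: (L.labels ++ R.properSubtrees.map label) := by
  rw [labels_eq, properSubtrees_graft, List.map_append, label_graft]
  rfl

theorem labels_graft_perm (L R : PlaneTree) : (graft L R).labels.Perm (L.labels ++ R.labels) := by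
  rw [labels_graft, labels_eq R]
  exact List.perm_middle.symm

/-- Labels increase along every edge. -/
def Incr (t : PlaneTree) : Prop := ∀ s ∈ t.subtrees, ∀ u ∈ s.children, s.label < u.label

theorem incr_leaf (a : ℕ) : (node a []).Incr := by
  simp [Incr, subtrees_eq, properSubtrees_leaf, children]

theorem incr_graft (L R : PlaneTree) :
    (graft L R).Incr ↔ R.label < L.label ∧ L.Incr ∧ R.Incr := by
  have key : ∀ t : PlaneTree, t.Incr ↔ (∀ u ∈ t.children, t.label < u.label) ∧
      ∀ s ∈ t.properSubtrees, ∀ u ∈ s.children, s.label < u.label := by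
    intro t
    rw [Incr, subtrees_eq, List.forall_mem_cons]
  have hc : (graft L R).children = L :: R.children := rfl
  rw [key (graft L R), key R, hc, List.forall_mem_cons, properSubtrees_graft,
    List.forall_mem_append, label_graft]
  rw [Incr]
  tauto

theorem label_mem_labels (t : PlaneTree) : t.label ∈ t.labels := by
  simp [labels_eq]

theorem Incr.label_le {t : PlaneTree} (h : t.Incr) : ∀ a ∈ t.labels, t.label ≤ a := by
  induction t using graft_induction with
  | hleaf a => simp [labels_eq, properSubtrees_leaf]
  | hgraft L a cs hL hR =>
    rw [node_cons] at h ⊢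
    rw [incr_graft] at h
    intro b hb
    rw [(labels_graft_perm _ _).mem_iff, List.mem_append] at hb
    rw [label_graft]
    rcases hb with hb | hb
    · exact h.1.le.trans (hL h.2.1 b hb)
    · exact hR h.2.2 b hb

end PlaneTree

open PlaneTree

/-! ### The splitting on label sets; finiteness. -/

theorem mem_increasingTrees {S : Finset ℕ} {t : PlaneTree} :
    t ∈ increasingTrees S ↔ t.labels.Nodup ∧ (∀ a, a ∈ t.labels ↔ a ∈ S) ∧ t.Incr := Iff.rfl

/-- The minimum `s` is forced to be the root label. The set `U` holds the labels of the first branch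
and is otherwise arbitrary: every label in it exceeds `s`, so grafting never breaks monotonicity. -/
theorem mem_increasingTrees_insert {s : ℕ} {V : Finset ℕ} (hs : ∀ v ∈ V, s < v)
    (t : PlaneTree) : t ∈ increasingTrees (insert s V) ↔ (V = ∅ ∧ t = node s []) ∨
      ∃ U ⊆ V, ∃ L ∈ increasingTrees U, ∃ R ∈ increasingTrees (insert s (V \ U)),
        t = graft L R := by
  have hsV : s ∉ V := fun h => lt_irrefl _ (hs s h)
  constructor
  · intro h
    have hlab : t.label = s := by
      apply le_antisymm
      · exact Incr.label_le h.2.2 s ((h.2.1 s).2 (Finset.mem_insert_self _ _))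
      · have := (h.2.1 _).1 t.label_mem_labels
        rcases Finset.mem_insert.1 this with h' | h'
        · exact h'.ge
        · exact (hs _ h').le
    obtain ⟨a, cs⟩ := t
    obtain rfl : a = s := hlab
    cases cs with
    | nil =>
      left
      refine ⟨?_, rfl⟩
      rw [Finset.eq_empty_iff_forall_notMem]
      intro v hv
      have := (h.2.1 v).2 (Finset.mem_insert_of_mem hv)
      simp [labels_eq, properSubtrees_leaf, label] at this
      subst this
      exact hsV hv
    | cons L cs =>
      right
      rw [node_cons] at h
      obtain ⟨hnd, hmem, hinc⟩ := mem_increasingTrees.1 h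
      have hp := labels_graft_perm L (node a cs)
      rw [hp.nodup_iff, List.nodup_append] at hnd
      rw [incr_graft] at hinc
      have hmem' : ∀ x, x ∈ L.labels ∨ x ∈ (node a cs).labels ↔ x = a ∨ x ∈ V := by
        intro x
        rw [← List.mem_append, ← hp.mem_iff, hmem, Finset.mem_insert]
      have ha : a ∈ (node a cs).labels := label_mem_labels _
      refine ⟨L.labels.toFinset, ?_, L, ⟨hnd.1, by simp, hinc.2.1⟩, node a cs,
        ⟨hnd.2.1, ?_, hinc.2.2⟩, rfl⟩
      · intro x hx
        rw [List.mem_toFinset] at hx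
        rcases (hmem' x).1 (Or.inl hx) with rfl | h'
        · exact absurd rfl (hnd.2.2 _ hx _ ha)
        · exact h'
      · intro x
        simp only [Finset.mem_insert, Finset.mem_sdiff, List.mem_toFinset]
        constructor
        · intro hx
          have hx' : x ∉ L.labels := fun h' => hnd.2.2 _ h' _ hx rfl
          rcases (hmem' x).1 (Or.inr hx) with h' | h'
          · exact Or.inl h'
          · exact Or.inr ⟨h', hx'⟩
        · rintro (rfl | ⟨h1, h2⟩)
          · exact ha
          · exact ((hmem' x).2 (Or.inr h1)).resolve_left h2
  · rintro (⟨rfl, rfl⟩ | ⟨U, hU, L, hL, R, hR, rfl⟩)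
    · refine ⟨?_, ?_, incr_leaf s⟩ <;> simp [labels_eq, properSubtrees_leaf, label]
    · have hp := labels_graft_perm L R
      rw [mem_increasingTrees] at hL hR ⊢
      refine ⟨?_, ?_, ?_⟩
      · rw [hp.nodup_iff, List.nodup_append]
        refine ⟨hL.1, hR.1, ?_⟩
        rintro x hx y hy rfl
        rw [hL.2.1] at hx
        rw [hR.2.1] at hy
        simp only [Finset.mem_insert, Finset.mem_sdiff] at hy
        rcases hy with rfl | hy
        · exact hsV (hU hx)
        · exact hy.2 hx
      · intro x
        rw [hp.mem_iff, List.mem_append, hL.2.1, hR.2.1]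
        simp only [Finset.mem_insert, Finset.mem_sdiff]
        have := @hU x
        tauto
      · rw [incr_graft]
        refine ⟨?_, hL.2.2, hR.2.2⟩
        have h1 := hR.2.2.label_le s ((hR.2.1 s).2 (Finset.mem_insert_self _ _))
        exact h1.trans_lt (hs _ (hU ((hL.2.1 _).1 L.label_mem_labels)))

theorem increasingTrees_empty : increasingTrees ∅ = ∅ := by
  ext t
  simp only [Set.mem_empty_iff_false, iff_false]
  intro h
  simpa using (h.2.1 _).1 t.label_mem_labels

theorem exists_min_insert {S : Finset ℕ} (hS : S.Nonempty) :
    ∃ s V, S = insert s V ∧ s ∉ V ∧ (∀ v ∈ V, s < v) := by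
  refine ⟨S.min' hS, S.erase (S.min' hS), (Finset.insert_erase (S.min'_mem hS)).symm,
    Finset.notMem_erase _ _, fun v hv => ?_⟩
  exact Finset.min'_lt_of_mem_erase_min' S hS hv

theorem card_insert_sdiff {s : ℕ} {U V : Finset ℕ} (hs : s ∉ V) (hU : U ⊆ V) :
    (insert s (V \ U)).card = V.card + 1 - U.card := by
  rw [Finset.card_insert_of_notMem (by simp [hs]), Finset.card_sdiff_of_subset hU]
  have := Finset.card_le_card hU
  omega

theorem finite_increasingTrees (S : Finset ℕ) : (increasingTrees S).Finite := by
  induction hn : S.card using Nat.strong_induction_on generalizing S with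
  | _ n ih =>
  rcases S.eq_empty_or_nonempty with rfl | hne
  · simp [increasingTrees_empty]
  obtain ⟨s, V, rfl, hsV, hs⟩ := exists_min_insert hne
  rw [Finset.card_insert_of_notMem hsV] at hn
  refine Set.Finite.subset (s := {node s []} ∪ ⋃ U ∈ V.powerset,
    Set.image2 graft (increasingTrees U) (increasingTrees (insert s (V \ U)))) ?_ ?_
  · refine (Set.finite_singleton _).union (Set.Finite.biUnion (Finset.finite_toSet _) ?_)
    intro U hU
    rw [SetLike.mem_coe, Finset.mem_powerset] at hU
    rcases U.eq_empty_or_nonempty with rfl | hUne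
    · simp [increasingTrees_empty]
    have := Finset.card_le_card hU
    have := hUne.card_pos
    exact (ih _ (by omega) U rfl).image2 _
      (ih _ (by rw [card_insert_sdiff hsV hU]; omega) _ rfl)
  · intro t ht
    rcases (mem_increasingTrees_insert hs t).1 ht with ⟨-, rfl⟩ | ⟨U, hU, L, hL, R, hR, rfl⟩
    · simp
    · right
      simp only [Set.mem_iUnion]
      exact ⟨U, Finset.mem_powerset.2 hU, Set.mem_image2_of_mem hL hR⟩

/-- The finite set of plane increasing trees with label set `S`. -/
noncomputable def treeFinset (S : Finset ℕ) : Finset PlaneTree :=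
  (finite_increasingTrees S).toFinset

theorem mem_treeFinset {S : Finset ℕ} {t : PlaneTree} :
    t ∈ treeFinset S ↔ t ∈ increasingTrees S := by
  simp [treeFinset]

theorem treeFinset_empty : treeFinset ∅ = ∅ := by
  ext t; simp [mem_treeFinset, increasingTrees_empty]

theorem sum_treeFinset_insert {s : ℕ} {V : Finset ℕ} (hs : ∀ v ∈ V, s < v)
    (g : PlaneTree → ℝ) : ∑ t ∈ treeFinset (insert s V), g t =
      (if V.card = 0 then g (node s []) else 0) +
      ∑ U ∈ V.powerset, ∑ L ∈ treeFinset U, ∑ R ∈ treeFinset (insert s (V \ U)),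
        g (graft L R) := by
  classical
  have hset : treeFinset (insert s V) = (if V.card = 0 then {node s []} else ∅) ∪
      (V.powerset.sigma fun U => treeFinset U ×ˢ treeFinset (insert s (V \ U))).image
        (fun x => graft x.2.1 x.2.2) := by
    ext t
    rw [mem_treeFinset, mem_increasingTrees_insert hs, Finset.mem_union, Finset.mem_image]
    apply or_congr
    · split_ifs with h <;> simp_all
    · constructor
      · rintro ⟨U, hU, L, hL, R, hR, rfl⟩
        exact ⟨⟨U, L, R⟩, by simp [mem_treeFinset, hU, hL, hR], rfl⟩
      · rintro ⟨⟨U, L, R⟩, h, rfl⟩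
        simp only [Finset.mem_sigma, Finset.mem_powerset, Finset.mem_product,
          mem_treeFinset] at h
        exact ⟨U, h.1, L, h.2.1, R, h.2.2, rfl⟩
  rw [hset, Finset.sum_union, Finset.sum_image, Finset.sum_sigma]
  · congr 1
    · split_ifs <;> simp
    · exact Finset.sum_congr rfl fun U _ => Finset.sum_product _ _ _
  · rintro ⟨U, L, R⟩ h ⟨U', L', R'⟩ h' heq
    obtain ⟨rfl, rfl⟩ := graft_inj heq
    simp only [Finset.coe_sigma, Set.mem_sigma_iff, SetLike.mem_coe, Finset.mem_powerset,
      Finset.mem_product, mem_treeFinset] at h h'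
    -- The block is recovered as the label set of the first branch.
    have : U = U' := by
      ext x
      rw [← h.2.1.2.1, ← h'.2.1.2.1]
    subst this
    rfl
  · rw [Finset.disjoint_left]
    intro t ht ht'
    split_ifs at ht
    · rw [Finset.mem_singleton] at ht
      subst ht
      simp [graft] at ht'
    · simp at ht

/-! ### Shapes and additive statistics. -/

namespace PlaneTree

/-- The unlabelled shape of a tree: all labels are replaced by `0`. -/
def skel : PlaneTree → PlaneTree
  | node _ cs => node 0 (cs.map skel)

theorem skel_node (a : ℕ) (cs : List PlaneTree) : (node a cs).skel = node 0 (cs.map skel) := by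
  rw [skel]

theorem skel_graft (L R : PlaneTree) : (graft L R).skel = graft L.skel R.skel := by
  cases R
  simp [graft, skel_node, label, children]

/-- The two halves are proved together because a graft contributes all subtrees of `L` but only the
proper ones of `R`. -/
theorem subtrees_skel (t : PlaneTree) : t.skel.subtrees = t.subtrees.map skel ∧
    t.skel.properSubtrees = t.properSubtrees.map skel := by
  induction t using graft_induction with
  | hleaf a => simp [skel_node, subtrees_eq, properSubtrees_leaf]
  | hgraft L a cs hL hR =>
    rw [node_cons, skel_graft, subtrees_eq, subtrees_eq, properSubtrees_graft,
      properSubtrees_graft, hL.1, hR.2, List.map_cons, List.map_append, skel_graft]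
    simp

theorem HasLeafAtDepth.to_skel {t : PlaneTree} {d : ℕ} (h : t.HasLeafAtDepth d) :
    t.skel.HasLeafAtDepth d := by
  induction h with
  | leaf a => rw [skel_node]; exact .leaf 0
  | step a cs s d hs _ ih => rw [skel_node]; exact .step 0 _ _ d (List.mem_map_of_mem hs) ih

theorem HasLeafAtDepth.of_skel {t : PlaneTree} {d : ℕ} (h : t.skel.HasLeafAtDepth d) :
    t.HasLeafAtDepth d := by
  induction d generalizing t with
  | zero =>
    obtain ⟨a, cs⟩ := t
    rw [skel_node] at h
    cases cs with
    | nil => exact .leaf a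
    | cons c cs =>
      generalize hl : (c :: cs).map skel = l at h
      cases h
      simp at hl
  | succ d ih =>
    obtain ⟨a, cs⟩ := t
    rw [skel_node] at h
    generalize hl : cs.map skel = l at h
    cases h with
    | step _ _ s _ hs h =>
      rw [← hl] at hs
      obtain ⟨u, hu, rfl⟩ := List.mem_map.1 hs
      exact .step a cs u d hu (ih h)

theorem rootRank_skel (t : PlaneTree) : t.skel.rootRank = t.rootRank := by
  unfold rootRank
  congr 1
  ext d
  exact ⟨HasLeafAtDepth.of_skel, HasLeafAtDepth.to_skel⟩

/-- The number of vertices. -/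
def size (t : PlaneTree) : ℝ := t.subtrees.length

/-- The indicator of the event that the root has rank `k`. -/
noncomputable def rankInd (k : ℕ) (t : PlaneTree) : ℝ := if t.rootRank = k then 1 else 0

/-- The number of vertices of rank `k`. -/
noncomputable def rankCount (k : ℕ) (t : PlaneTree) : ℝ := (t.subtrees.map (rankInd k)).sum

/-- The number of non-root vertices of rank `k`. -/
noncomputable def properRankCount (k : ℕ) (t : PlaneTree) : ℝ :=
  (t.properSubtrees.map (rankInd k)).sum

/-- A quantity that depends on the shape of the tree only. -/
def ShapeInvariant (g : PlaneTree → ℝ) : Prop := ∀ t, g t.skel = g t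

theorem shapeInvariant_size : ShapeInvariant size := by
  intro t
  simp [size, (subtrees_skel t).1]

theorem shapeInvariant_rankInd (k : ℕ) : ShapeInvariant (rankInd k) := by
  intro t
  simp [rankInd, rootRank_skel]

theorem shapeInvariant_properRankCount (k : ℕ) : ShapeInvariant (properRankCount k) := by
  intro t
  rw [properRankCount, (subtrees_skel t).2, List.map_map, properRankCount]
  congr 1
  exact List.map_congr_left fun s _ => shapeInvariant_rankInd k s

theorem rankCount_eq (k : ℕ) (t : PlaneTree) :
    rankCount k t = rankInd k t + properRankCount k t := by
  rw [rankCount, subtrees_eq, List.map_cons, List.sum_cons, properRankCount]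

theorem properRankCount_graft (k : ℕ) (L R : PlaneTree) :
    properRankCount k (graft L R) = rankCount k L + properRankCount k R := by
  rw [properRankCount, properSubtrees_graft, List.map_append, List.sum_append, rankCount,
    properRankCount]

theorem properRankCount_leaf (k a : ℕ) : properRankCount k (node a []) = 0 := by
  simp [properRankCount, properSubtrees_leaf]

theorem size_graft (L R : PlaneTree) : size (graft L R) = size L + size R := by
  rw [size, subtrees_eq, properSubtrees_graft, size, size, subtrees_eq R]
  simp
  ring

theorem size_leaf (a : ℕ) : size (node a []) = 1 := by
  simp [size, subtrees_eq, properSubtrees_leaf]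

theorem rankInd_nonneg (k : ℕ) (t : PlaneTree) : 0 ≤ rankInd k t := by
  unfold rankInd; split_ifs <;> norm_num

theorem rankInd_le_one (k : ℕ) (t : PlaneTree) : rankInd k t ≤ 1 := by
  unfold rankInd; split_ifs <;> norm_num

end PlaneTree

theorem size_of_mem {S : Finset ℕ} {t : PlaneTree} (h : t ∈ increasingTrees S) :
    size t = S.card := by
  have h1 : t.labels.toFinset = S := by
    ext x
    rw [List.mem_toFinset, h.2.1]
  rw [← h1, List.toFinset_card_of_nodup h.1, labels, List.length_map, size]

/-! ### Sums over trees depend only on the number of labels. -/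

/-- The sum of `h` over the shapes of the trees on `n` labels. -/
noncomputable def shapeSum (n : ℕ) (h : PlaneTree → ℝ) : ℝ :=
  ∑ t ∈ treeFinset (Finset.range n), h t.skel

theorem shapeSum_zero (h : PlaneTree → ℝ) : shapeSum 0 h = 0 := by
  simp [shapeSum, treeFinset_empty]

/-- Subsets `U` are grouped by cardinality. Independence of the label set is taken as the hypothesis
`ih`, so that the identity serves both inside the induction that proves this independence and
afterwards. -/
theorem sum_insert_shape {s m : ℕ} {V : Finset ℕ} (hs : ∀ v ∈ V, s < v) (hm : V.card = m)
    (ih : ∀ S : Finset ℕ, S.card ≤ m → ∀ h : PlaneTree → ℝ,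
      ∑ t ∈ treeFinset S, h t.skel = shapeSum S.card h) (h : PlaneTree → ℝ) :
    ∑ t ∈ treeFinset (insert s V), h t.skel = (if m = 0 then h (node 0 []) else 0) +
      ∑ j ∈ Finset.range (m + 1), (m.choose j : ℝ) *
        shapeSum j (fun x => shapeSum (m + 1 - j) (fun y => h (graft x y))) := by
  rw [sum_treeFinset_insert hs, hm, skel_node, List.map_nil]
  congr 1
  have hsV : s ∉ V := fun h => lt_irrefl _ (hs s h)
  rw [← hm]
  simp_rw [← nsmul_eq_mul]
  rw [← Finset.sum_powerset_apply_card
    (fun j => shapeSum j (fun x => shapeSum (V.card + 1 - j) (fun y => h (graft x y))))]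
  refine Finset.sum_congr rfl fun U hU => ?_
  rw [Finset.mem_powerset] at hU
  rcases U.eq_empty_or_nonempty with rfl | hne
  · simp [treeFinset_empty, shapeSum_zero]
  have h1 := Finset.card_le_card hU
  have h2 := hne.card_pos
  rw [← ih U (by omega)]
  refine Finset.sum_congr rfl fun L _ => ?_
  rw [← card_insert_sdiff hsV hU, ← ih _ (by rw [card_insert_sdiff hsV hU]; omega)]
  simp_rw [skel_graft]

/-- This replaces a relabelling bijection: the recursion of `sum_insert_shape` involves the label
set only through its size, so any two sets of equal size give equal sums. -/
theorem sum_treeFinset_skel (S : Finset ℕ) (h : PlaneTree → ℝ) :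
    ∑ t ∈ treeFinset S, h t.skel = shapeSum S.card h := by
  induction hn : S.card using Nat.strong_induction_on generalizing S h with
  | _ n ih =>
  have key : ∀ S : Finset ℕ, S.card = n → ∀ m, n = m + 1 → ∑ t ∈ treeFinset S, h t.skel =
      (if m = 0 then h (node 0 []) else 0) + ∑ j ∈ Finset.range (m + 1), (m.choose j : ℝ) *
        shapeSum j (fun x => shapeSum (m + 1 - j) (fun y => h (graft x y))) := by
    intro S hS m hm
    obtain ⟨s, V, rfl, hsV, hs⟩ := exists_min_insert (S := S) (Finset.card_pos.1 (by omega))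
    rw [Finset.card_insert_of_notMem hsV] at hS
    exact sum_insert_shape hs (by omega) (fun S hS h => ih _ (by omega) S h rfl) h
  rcases n with _ | m
  · rw [Finset.card_eq_zero] at hn
    subst hn
    simp [treeFinset_empty, shapeSum_zero]
  · rw [key S hn m rfl, shapeSum, key (Finset.range (m + 1)) (by simp) m rfl]

/-- The sum of `g` over all plane increasing trees on `{1, …, n}`. -/
noncomputable def treeSum (g : PlaneTree → ℝ) (n : ℕ) : ℝ :=
  ∑ t ∈ treeFinset (Finset.Icc 1 n), g t

theorem treeSum_eq_shapeSum {g : PlaneTree → ℝ} (hg : ShapeInvariant g) (n : ℕ) :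
    treeSum g n = shapeSum n g := by
  have := sum_treeFinset_skel (Finset.Icc 1 n) g
  rw [Nat.card_Icc, Nat.add_sub_cancel] at this
  rw [← this]
  exact Finset.sum_congr rfl fun t _ => (hg t).symm

theorem treeSum_zero (g : PlaneTree → ℝ) : treeSum g 0 = 0 := by
  simp [treeSum, treeFinset_empty]

theorem treeSum_succ {g : PlaneTree → ℝ} (hg : ShapeInvariant g) (n : ℕ) :
    treeSum g (n + 1) = (if n = 0 then g (node 0 []) else 0) +
      ∑ j ∈ Finset.range (n + 1), (n.choose j : ℝ) *
        treeSum (fun L => treeSum (fun R => g (graft L R)) (n + 1 - j)) j := by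
  obtain ⟨s, V, hSV, hsV, hs⟩ := exists_min_insert (S := Finset.range (n + 1)) (by simp)
  have hV : V.card = n := by
    have := congrArg Finset.card hSV
    rw [Finset.card_insert_of_notMem hsV, Finset.card_range] at this
    omega
  have hsum := sum_insert_shape hs hV (fun S _ h => sum_treeFinset_skel S h) g
  rw [← hSV] at hsum
  rw [treeSum_eq_shapeSum hg, shapeSum, hsum]
  congr 1
  refine Finset.sum_congr rfl fun j _ => ?_
  congr 1
  have e : ∀ m h, shapeSum m h = ∑ t ∈ treeFinset (Finset.Icc 1 m), h t.skel := by
    intro m h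
    rw [sum_treeFinset_skel, Nat.card_Icc, Nat.add_sub_cancel]
  rw [e, treeSum]
  refine Finset.sum_congr rfl fun L _ => ?_
  rw [e, treeSum]
  refine Finset.sum_congr rfl fun R _ => ?_
  rw [← skel_graft, hg]

/-! ### Generating functions and the number of trees. -/

/-- The exponential generating function of `treeSum g`, as a formal power series. -/
noncomputable def treeSeries (g : PlaneTree → ℝ) : PowerSeries ℝ :=
  PowerSeries.mk fun n => treeSum g n / (n.factorial : ℝ)

open PowerSeries in
theorem coeff_derivative_treeSeries (g : PlaneTree → ℝ) (n : ℕ) :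
    coeff n (derivative ℝ (treeSeries g)) = treeSum g (n + 1) / (n.factorial : ℝ) := by
  rw [coeff_derivative, treeSeries, coeff_mk, Nat.factorial_succ]
  push_cast
  have : (n.factorial : ℝ) ≠ 0 := by positivity
  field_simp

open PowerSeries in
theorem coeff_treeSeries_mul_derivative (α β : PlaneTree → ℝ) (n : ℕ) :
    coeff n (treeSeries α * derivative ℝ (treeSeries β)) =
      (∑ j ∈ Finset.range (n + 1), (n.choose j : ℝ) *
        (treeSum α j * treeSum β (n + 1 - j))) / (n.factorial : ℝ) := by
  rw [coeff_mul, Finset.Nat.sum_antidiagonal_eq_sum_range_succ_mk, Finset.sum_div]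
  refine Finset.sum_congr rfl fun j hj => ?_
  have hj' : j ≤ n := by simpa [Nat.lt_succ_iff] using hj
  dsimp only
  rw [coeff_derivative_treeSeries, treeSeries, coeff_mk, Nat.cast_choose ℝ hj',
    show n - j + 1 = n + 1 - j by omega]
  have h1 : (n.factorial : ℝ) ≠ 0 := by positivity
  have h2 : (j.factorial : ℝ) ≠ 0 := by positivity
  have h3 : ((n - j).factorial : ℝ) ≠ 0 := by positivity
  field_simp

open PowerSeries in
/-- The root decomposition as a differential equation for generating functions. -/
theorem derivative_treeSeries {m : ℕ} {g : PlaneTree → ℝ} {α β : Fin m → PlaneTree → ℝ}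
    (hg : ShapeInvariant g) (h : ∀ L R, g (graft L R) = ∑ i, α i L * β i R) :
    derivative ℝ (treeSeries g) = C (g (node 0 [])) +
      ∑ i, treeSeries (α i) * derivative ℝ (treeSeries (β i)) := by
  ext n
  rw [coeff_derivative_treeSeries, treeSum_succ hg, map_add, map_sum, coeff_C, add_div]
  congr 1
  · split_ifs with hn
    · simp [hn]
    · simp
  · simp_rw [coeff_treeSeries_mul_derivative, ← Finset.sum_div]
    rw [Finset.sum_comm]
    congr 1
    refine Finset.sum_congr rfl fun j _ => ?_
    rw [← Finset.mul_sum]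
    congr 1
    simp only [treeSum, h]
    simp_rw [Finset.sum_mul_sum]
    symm
    rw [Finset.sum_comm]
    refine Finset.sum_congr rfl fun L _ => ?_
    rw [Finset.sum_comm]

/-- The number of plane increasing trees on `{1, …, n}`. -/
noncomputable def treeNum (n : ℕ) : ℝ := treeSum (fun _ => 1) n

open PowerSeries in
theorem derivative_treeSeries_one :
    derivative ℝ (treeSeries fun _ => 1) =
      1 + (treeSeries fun _ => 1) * derivative ℝ (treeSeries fun _ => 1) := by
  have := derivative_treeSeries (m := 1) (g := fun _ => 1) (α := fun _ _ => 1)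
    (β := fun _ _ => 1) (fun _ => rfl) (by simp)
  simpa using this

open PowerSeries in
theorem one_sub_treeSeries_mul_derivative :
    (1 - treeSeries fun _ => 1) * derivative ℝ (treeSeries fun _ => 1) = 1 := by
  linear_combination derivative_treeSeries_one

open PowerSeries in
-- Both sides have constant term 1 and derivative -2. This is T = 1 - √(1 - 2X) without square roots
-- of power series.
theorem one_sub_treeSeries_sq : (1 - treeSeries fun _ => 1) ^ 2 = 1 - 2 * (X : PowerSeries ℝ) := by
  apply derivative.ext
  · have h := one_sub_treeSeries_mul_derivative
    rw [derivative_pow, map_sub, map_sub, Derivation.leibniz, derivative_X, derivative_one]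
    have h2 : derivative ℝ (2 : PowerSeries ℝ) = 0 := by
      have : (2 : PowerSeries ℝ) = C (2 : ℝ) := (map_ofNat C 2).symm
      rw [this, derivative_C]
    rw [h2]
    simp only [smul_eq_mul, Nat.cast_ofNat]
    linear_combination (-2) * h
  · simp [treeSeries, treeSum_zero]

open PowerSeries in
theorem one_sub_two_X_mul_derivative_sq :
    (1 - 2 * (X : PowerSeries ℝ)) * derivative ℝ (treeSeries fun _ => 1) ^ 2 = 1 := by
  have h := one_sub_treeSeries_mul_derivative
  rw [← one_sub_treeSeries_sq, ← mul_pow, h, one_pow]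

open PowerSeries in
theorem coeff_one_sub_two_X_mul (f : PowerSeries ℝ) (n : ℕ) :
    coeff (n + 1) ((1 - 2 * X) * f) = coeff (n + 1) f - 2 * coeff n f := by
  have : (1 - 2 * X) * f = f - C 2 * (X * f) := by
    rw [map_ofNat]; ring
  rw [this, map_sub, coeff_C_mul, coeff_succ_X_mul]

open PowerSeries in
-- Differentiating (1 - T) D = 1 gives D' = D³, hence (1 - 2X) D' = D; the recurrence compares
-- coefficients.
theorem treeNum_succ_succ (n : ℕ) : treeNum (n + 2) = (2 * n + 1) * treeNum (n + 1) := by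
  set T := treeSeries fun _ => 1 with hT
  set D := derivative ℝ T with hD
  have h1 : (1 - T) * D = 1 := one_sub_treeSeries_mul_derivative
  have h2 : (1 - 2 * X) * D ^ 2 = 1 := one_sub_two_X_mul_derivative_sq
  have h3 : derivative ℝ ((1 - T) * D) = 0 := by rw [h1, derivative_one]
  rw [Derivation.leibniz, map_sub, derivative_one, ← hD] at h3
  simp only [smul_eq_mul] at h3
  have h4 : derivative ℝ D = D ^ 3 := by
    linear_combination D * h3 - derivative ℝ D * h1
  have h5 : (1 - 2 * X) * derivative ℝ D = D := by
    rw [h4]; linear_combination D * h2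
  have c : ∀ m, coeff m D = treeNum (m + 1) / (m.factorial : ℝ) :=
    fun m => coeff_derivative_treeSeries _ m
  have c' : ∀ m, coeff m (derivative ℝ D) = treeNum (m + 2) / (m.factorial : ℝ) := by
    intro m
    rw [coeff_derivative, c, Nat.factorial_succ]
    push_cast
    have : (m.factorial : ℝ) ≠ 0 := by positivity
    field_simp
  -- The shifted coefficient formula says nothing about the constant term, which is read off from D'
  -- = D³ instead.
  rcases n with _ | n
  · have := congrArg (coeff 0) h4
    have h6 := congrArg (coeff 0) h1
    rw [c'] at this
    have hc : constantCoeff T = 0 := by simp [hT, treeSeries, treeSum_zero]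
    have h7 : constantCoeff D = treeNum 1 := by
      have := c 0
      simpa using this
    simp [hc, h7] at h6
    simp [h7, h6] at this
    simp [this, h6]
  · have := congrArg (coeff (n + 1)) h5
    rw [coeff_one_sub_two_X_mul, c, c', c', Nat.factorial_succ] at this
    push_cast at this ⊢
    have hn : (n.factorial : ℝ) ≠ 0 := by positivity
    field_simp at this
    linear_combination this

theorem treeNum_one : treeNum 1 = 1 := by
  have := treeSum_succ (g := fun _ => 1) (fun _ => rfl) 0
  simpa [treeSum_zero, treeNum] using this

theorem treeNum_zero : treeNum 0 = 0 := treeSum_zero _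

theorem treeNum_pos (n : ℕ) (hn : 1 ≤ n) : 0 < treeNum n := by
  induction n, hn using Nat.le_induction with
  | base => rw [treeNum_one]; norm_num
  | succ n hn ih =>
    obtain ⟨m, rfl⟩ := Nat.exists_eq_add_of_le' hn
    rw [treeNum_succ_succ]
    positivity

theorem treeNum_succ (n : ℕ) (hn : 1 ≤ n) : treeNum (n + 1) = (2 * n - 1) * treeNum n := by
  obtain ⟨m, rfl⟩ := Nat.exists_eq_add_of_le' hn
  rw [treeNum_succ_succ]
  push_cast
  ring

theorem treeNum_nonneg (n : ℕ) : 0 ≤ treeNum n := by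
  rcases n with _ | n
  · rw [treeNum_zero]
  · exact (treeNum_pos _ (by omega)).le

/-! ### The mean number of vertices of rank k. -/

open PowerSeries in
/-- Non-root vertices of rank `k`: their total number in terms of all vertices of rank `k`. -/
theorem treeSum_properRankCount_succ (k n : ℕ) (hn : 1 ≤ n) :
    treeSum (properRankCount k) (n + 1) =
      2 * n * treeSum (properRankCount k) n + treeSum (rankCount k) n := by
  have h := derivative_treeSeries (m := 2) (g := properRankCount k)
    (α := ![rankCount k, fun _ => 1]) (β := ![fun _ => 1, properRankCount k])
    (shapeInvariant_properRankCount k) (by simp [properRankCount_graft])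
  simp only [Fin.sum_univ_two, Matrix.cons_val_zero, Matrix.cons_val_one,
    properRankCount_leaf, map_zero, zero_add] at h
  set T := treeSeries fun _ => 1 with hT
  have h1 : (1 - T) * derivative ℝ T = 1 := one_sub_treeSeries_mul_derivative
  have h2 := one_sub_treeSeries_sq
  rw [← hT] at h2
  -- The equation is (1 - T) Q' = P T'. Multiplying once more by 1 - T removes T' on the right and
  -- leaves 1 - 2X on the left.
  have h3 : (1 - 2 * X) * derivative ℝ (treeSeries (properRankCount k)) =
      treeSeries (rankCount k) := by
    rw [← h2]
    linear_combination (1 - T) * h + treeSeries (rankCount k) * h1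
  obtain ⟨n, rfl⟩ := Nat.exists_eq_add_of_le' hn
  have := congrArg (coeff (n + 1)) h3
  rw [coeff_one_sub_two_X_mul, coeff_derivative_treeSeries, coeff_derivative_treeSeries,
    treeSeries, coeff_mk, Nat.factorial_succ] at this
  have hn : (n.factorial : ℝ) ≠ 0 := by positivity
  push_cast at this ⊢
  field_simp at this
  linear_combination this

theorem treeSum_add (f g : PlaneTree → ℝ) (n : ℕ) :
    treeSum (fun t => f t + g t) n = treeSum f n + treeSum g n := Finset.sum_add_distrib

theorem treeSum_sub (f g : PlaneTree → ℝ) (n : ℕ) :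
    treeSum (fun t => f t - g t) n = treeSum f n - treeSum g n := Finset.sum_sub_distrib ..

theorem treeSum_const_mul (a : ℝ) (f : PlaneTree → ℝ) (n : ℕ) :
    treeSum (fun t => a * f t) n = a * treeSum f n := (Finset.mul_sum ..).symm

theorem treeSum_mono {f g : PlaneTree → ℝ} (h : ∀ t, f t ≤ g t) (n : ℕ) :
    treeSum f n ≤ treeSum g n := Finset.sum_le_sum fun t _ => h t

theorem treeSum_nonneg {f : PlaneTree → ℝ} (h : ∀ t, 0 ≤ f t) (n : ℕ) :
    0 ≤ treeSum f n := Finset.sum_nonneg fun t _ => h t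

theorem treeSum_size (n : ℕ) : treeSum size n = n * treeNum n := by
  rw [treeNum, ← treeSum_const_mul]
  refine Finset.sum_congr rfl fun t ht => ?_
  rw [mem_treeFinset] at ht
  rw [size_of_mem ht]
  simp

theorem treeSum_rankCount (k n : ℕ) : treeSum (rankCount k) n =
    treeSum (rankInd k) n + treeSum (properRankCount k) n := by
  rw [← treeSum_add]
  congr 1
  funext t
  exact rankCount_eq k t

/-- The probability that the root of a random tree on `{1, …, n}` has rank `k`. -/
noncomputable def rootProb (k n : ℕ) : ℝ := treeSum (rankInd k) n / treeNum n

theorem rootProb_nonneg (k n : ℕ) : 0 ≤ rootProb k n :=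
  div_nonneg (treeSum_nonneg (rankInd_nonneg k) n) (treeNum_nonneg n)

theorem rootProb_le_one (k n : ℕ) : rootProb k n ≤ 1 :=
  div_le_one_of_le₀ (treeSum_mono (rankInd_le_one k) n) (treeNum_nonneg n)

/-- The proportion of vertices whose subtree has `i + 1` vertices and root rank `k`. -/
noncomputable def fringeWeight (k i : ℕ) : ℝ := rootProb k (i + 1) / ((2 * i + 1) * (2 * i + 3))

/-- After division by `treeNum (n + 1) * (2 * n + 1)` the recurrence telescopes, each step adding
one fringe weight. -/
theorem treeSum_properRankCount (k n : ℕ) : treeSum (properRankCount k) (n + 1) =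
    treeNum (n + 1) * (2 * n + 1) * ∑ i ∈ Finset.range n, fringeWeight k i := by
  induction n with
  | zero =>
    have := treeSum_succ (shapeInvariant_properRankCount k) 0
    simpa [treeSum_zero, properRankCount_leaf] using this
  | succ n ih =>
    rw [treeSum_properRankCount_succ _ _ (by omega), treeSum_rankCount, ih, treeNum_succ_succ,
      Finset.sum_range_succ, fringeWeight, rootProb]
    have := (treeNum_pos (n + 1) (by omega)).ne'
    have h1 : (2 * (n : ℝ) + 1) ≠ 0 := by positivity
    have h2 : (2 * (n : ℝ) + 3) ≠ 0 := by positivity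
    push_cast
    field_simp
    ring

theorem fringeWeight_nonneg (k i : ℕ) : 0 ≤ fringeWeight k i :=
  div_nonneg (rootProb_nonneg _ _) (by positivity)

theorem fringeWeight_le (k i : ℕ) : fringeWeight k i ≤ 1 / ((2 * i + 1) * (2 * i + 3)) :=
  div_le_div_of_nonneg_right (rootProb_le_one _ _) (by positivity)

theorem sum_range_inv_odd_mul (n : ℕ) :
    ∑ i ∈ Finset.range n, (1 : ℝ) / ((2 * i + 1) * (2 * i + 3)) =
      1 / 2 - 1 / (2 * (2 * n + 1)) := by
  induction n with
  | zero => simp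
  | succ n ih =>
    rw [Finset.sum_range_succ, ih]
    push_cast
    have h1 : (2 * (n : ℝ) + 1) ≠ 0 := by positivity
    have h2 : (2 * (n : ℝ) + 3) ≠ 0 := by positivity
    have h3 : (2 * ((n : ℝ) + 1) + 1) ≠ 0 := by positivity
    field_simp
    ring

theorem hasSum_inv_odd_mul :
    HasSum (fun i : ℕ => (1 : ℝ) / ((2 * i + 1) * (2 * i + 3))) (1 / 2) := by
  rw [hasSum_iff_tendsto_nat_of_nonneg (fun i => by positivity)]
  simp_rw [sum_range_inv_odd_mul]
  have : Tendsto (fun n : ℕ => (2 : ℝ) * (2 * n + 1)) atTop atTop := by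
    refine Tendsto.const_mul_atTop (by norm_num) (tendsto_atTop_add_const_right _ _ ?_)
    exact tendsto_natCast_atTop_atTop.const_mul_atTop (by norm_num)
  simpa using (tendsto_const_nhds (x := (1 / 2 : ℝ))).sub
    ((tendsto_const_nhds (x := (1 : ℝ))).div_atTop this)

theorem summable_fringeWeight (k : ℕ) : Summable (fringeWeight k) :=
  Summable.of_nonneg_of_le (fringeWeight_nonneg k) (fringeWeight_le k) hasSum_inv_odd_mul.summable

theorem sum_fringeWeight_le_tsum (k n : ℕ) :
    ∑ i ∈ Finset.range n, fringeWeight k i ≤ ∑' i, fringeWeight k i :=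
  (summable_fringeWeight k).sum_le_tsum _ fun i _ => fringeWeight_nonneg k i

/-- Root probabilities are at most 1, so the tail is bounded by an explicit telescoping tail. Its
order 1/n is what keeps the bias bounded after multiplication by 2n + 1. -/
theorem tsum_fringeWeight_le (k n : ℕ) :
    ∑' i, fringeWeight k i ≤
      ∑ i ∈ Finset.range n, fringeWeight k i + 1 / (2 * (2 * n + 1)) := by
  have h1 := (summable_fringeWeight k).sum_add_tsum_nat_add n
  have h2 := hasSum_inv_odd_mul.summable.sum_add_tsum_nat_add n
  rw [hasSum_inv_odd_mul.tsum_eq, sum_range_inv_odd_mul] at h2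
  have h3 : ∑' i, fringeWeight k (i + n) ≤
      ∑' i : ℕ, (1 : ℝ) / ((2 * (i + n : ℕ) + 1) * (2 * (i + n : ℕ) + 3)) :=
    Summable.tsum_le_tsum (fun i => fringeWeight_le k (i + n))
      ((summable_nat_add_iff n).2 (summable_fringeWeight k))
      ((summable_nat_add_iff n).2 hasSum_inv_odd_mul.summable)
  linarith

/-- The limiting proportion of vertices of rank `k`. -/
noncomputable def rankDensity (k : ℕ) : ℝ := 2 * ∑' i, fringeWeight k i

theorem rankDensity_nonneg (k : ℕ) : 0 ≤ rankDensity k :=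
  mul_nonneg (by norm_num) (tsum_nonneg (fringeWeight_nonneg k))

theorem rankDensity_le_one (k : ℕ) : rankDensity k ≤ 1 := by
  have := tsum_fringeWeight_le k 0
  simp at this
  rw [rankDensity]
  linarith

/-! ### Bounded bias and linear variance. -/

/-- The number of non-root vertices of rank `k`, centred. -/
noncomputable def properDeviation (k : ℕ) (t : PlaneTree) : ℝ :=
  properRankCount k t - rankDensity k * size t

/-- The number of vertices of rank `k`, centred. -/
noncomputable def deviation (k : ℕ) (t : PlaneTree) : ℝ :=
  rankCount k t - rankDensity k * size t

theorem deviation_eq (k : ℕ) (t : PlaneTree) :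
    deviation k t = properDeviation k t + rankInd k t := by
  rw [deviation, properDeviation, rankCount_eq]
  ring

theorem properDeviation_graft (k : ℕ) (L R : PlaneTree) :
    properDeviation k (graft L R) = deviation k L + properDeviation k R := by
  rw [deviation, properDeviation, properDeviation, properRankCount_graft, size_graft]
  ring

theorem shapeInvariant_properDeviation (k : ℕ) : ShapeInvariant (properDeviation k) := by
  intro t
  rw [properDeviation, shapeInvariant_properRankCount, shapeInvariant_size, properDeviation]

/-- The main terms cancel because `rankDensity` is twice the full series. What remains is 2n + 1
times the tail, at most 1/2, plus the mismatch between n + 1/2 and n + 1. -/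
theorem abs_treeSum_properDeviation_le (k n : ℕ) :
    |treeSum (properDeviation k) n| ≤ treeNum n := by
  rcases n with _ | n
  · simp [treeSum_zero, treeNum_zero]
  have h : treeSum (properDeviation k) (n + 1) = treeNum (n + 1) *
      ((2 * n + 1) * ∑ i ∈ Finset.range n, fringeWeight k i - rankDensity k * (n + 1)) := by
    have : treeSum (properDeviation k) (n + 1) = treeSum (properRankCount k) (n + 1) -
        rankDensity k * treeSum size (n + 1) := by
      rw [← treeSum_const_mul, ← treeSum_sub]
      rfl
    rw [this, treeSum_properRankCount, treeSum_size]
    push_cast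
    ring
  have ht := treeNum_nonneg (n + 1)
  rw [h, abs_mul, abs_of_nonneg ht]
  refine mul_le_of_le_one_right ht ?_
  have h1 := sum_fringeWeight_le_tsum k n
  have h2 := tsum_fringeWeight_le k n
  have h0 := rankDensity_nonneg k
  have h3 := rankDensity_le_one k
  have hW : ∑' i, fringeWeight k i = rankDensity k / 2 := by rw [rankDensity]; ring
  rw [hW] at h1 h2
  set S := ∑ i ∈ Finset.range n, fringeWeight k i
  have hp : (0 : ℝ) < 2 * n + 1 := by positivity
  have h4 := mul_le_mul_of_nonneg_left h1 hp.le
  have h5 := mul_le_mul_of_nonneg_left h2 hp.le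
  have h6 : (2 * (n : ℝ) + 1) * (S + 1 / (2 * (2 * n + 1))) = (2 * n + 1) * S + 1 / 2 := by
    field_simp
  rw [h6] at h5
  rw [abs_le]
  constructor <;> nlinarith

theorem abs_treeSum_deviation_le (k n : ℕ) : |treeSum (deviation k) n| ≤ 2 * treeNum n := by
  have h : treeSum (deviation k) n = treeSum (properDeviation k) n + treeSum (rankInd k) n := by
    rw [← treeSum_add]
    congr 1
    funext t
    exact deviation_eq k t
  have h1 := abs_le.1 (abs_treeSum_properDeviation_le k n)
  have h2 := treeSum_nonneg (rankInd_nonneg k) n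
  have h3 : treeSum (rankInd k) n ≤ treeNum n := treeSum_mono (rankInd_le_one k) n
  rw [h, abs_le]
  constructor <;> linarith

open PowerSeries in
theorem coeff_mul_le_coeff_mul {f g h : PowerSeries ℝ} (hfg : ∀ n, coeff n f ≤ coeff n g)
    (hh : ∀ n, 0 ≤ coeff n h) (n : ℕ) : coeff n (f * h) ≤ coeff n (g * h) := by
  rw [coeff_mul, coeff_mul]
  exact Finset.sum_le_sum fun i _ => mul_le_mul_of_nonneg_right (hfg _) (hh _)

open PowerSeries in
/-- Upper bound for the second moment of the centred number of non-root vertices of rank `k` by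
the solution of a first order recurrence. -/
theorem exists_recurrence_bound (k : ℕ) : ∃ e : ℕ → ℝ,
    (∀ n, treeSum (fun t => properDeviation k t ^ 2) (n + 1) ≤ e n) ∧
    ∀ n, e (n + 1) = 2 * (n + 1) * e n + treeSum (fun t => deviation k t ^ 2) (n + 1) := by
  have h := derivative_treeSeries (m := 3) (g := fun t => properDeviation k t ^ 2)
    (α := ![fun t => deviation k t ^ 2, fun _ => 1, fun t => 2 * deviation k t])
    (β := ![fun _ => 1, fun t => properDeviation k t ^ 2, properDeviation k])
    (fun t => by dsimp only; rw [shapeInvariant_properDeviation])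
    (fun L R => by rw [properDeviation_graft]; simp [Fin.sum_univ_three]; ring)
  simp only [Fin.sum_univ_three, Matrix.cons_val_zero, Matrix.cons_val_one,
    Matrix.cons_val] at h
  set T := treeSeries fun _ => 1 with hT
  set D := derivative ℝ T with hD
  set P := treeSeries fun t => deviation k t ^ 2 with hP
  set Q := treeSeries fun t => properDeviation k t ^ 2 with hQ
  have h1 : (1 - T) * D = 1 := one_sub_treeSeries_mul_derivative
  have h2 : (1 - 2 * X) * D ^ 2 = 1 := one_sub_two_X_mul_derivative_sq
  -- The one-vertex tree and the cross term 2 · deviation(L) · properDeviation(R) of the square.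
  set W := C (properDeviation k (node 0 []) ^ 2) +
    treeSeries (fun t => 2 * deviation k t) * derivative ℝ (treeSeries (properDeviation k)) with hW
  have hQ' : derivative ℝ Q = (P * D + W) * D := by
    rw [hW]
    linear_combination D * h - derivative ℝ Q * h1
  have cD : ∀ n, 0 ≤ coeff n D := fun n => by
    rw [hD, coeff_derivative_treeSeries]
    exact div_nonneg (treeNum_nonneg _) (by positivity)
  -- The sums in the cross term are at most 2 · `treeNum` and `treeNum`, so with the factor 2 it is
  -- dominated by 4 T D; the constant is at most 1 ≤ 4, and 4 + 4 T D = 4 D.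
  have cW : ∀ n, coeff n W ≤ coeff n (C 4 * D) := by
    intro n
    have hD1 : C 4 * D = C 4 + C 4 * (T * D) := by linear_combination C 4 * h1
    rw [hD1, hW, map_add, map_add]
    refine add_le_add ?_ ?_
    · rw [coeff_C, coeff_C]
      split_ifs with hn
      · rw [properDeviation, properRankCount_leaf, size_leaf]
        have := rankDensity_le_one k
        have := rankDensity_nonneg k
        nlinarith
      · rfl
    · rw [coeff_C_mul, coeff_treeSeries_mul_derivative, coeff_treeSeries_mul_derivative,
        ← mul_div_assoc, Finset.mul_sum]
      refine div_le_div_of_nonneg_right (Finset.sum_le_sum fun j _ => ?_) (by positivity)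
      rw [mul_left_comm (4 : ℝ)]
      refine mul_le_mul_of_nonneg_left ?_ (by positivity)
      rw [treeSum_const_mul]
      have a1 := abs_treeSum_deviation_le k j
      have a2 := abs_treeSum_properDeviation_le k (n + 1 - j)
      have a3 := mul_le_mul a1 a2 (abs_nonneg _) (by have := treeNum_nonneg j; positivity)
      rw [← abs_mul] at a3
      have a4 := le_abs_self (treeSum (deviation k) j * treeSum (properDeviation k) (n + 1 - j))
      change _ ≤ 4 * (treeNum j * treeNum (n + 1 - j))
      linarith
  -- Since D² is the inverse of 1 - 2X, this majorant of Q' satisfies a first order recurrence.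
  set E := (P + C 4) * D ^ 2 with hE
  have hcE : ∀ n, coeff n (derivative ℝ Q) ≤ coeff n E := by
    intro n
    have : E = (P * D + C 4 * D) * D := by rw [hE]; ring
    rw [this, hQ']
    refine coeff_mul_le_coeff_mul (fun m => ?_) cD n
    rw [map_add, map_add _ (P * D)]
    exact add_le_add le_rfl (cW m)
  have hE2 : (1 - 2 * X) * E = P + C 4 := by
    rw [hE]
    linear_combination (P + C 4) * h2
  refine ⟨fun n => n.factorial * coeff n E, fun n => ?_, fun n => ?_⟩
  · have := hcE n
    have hn : (0 : ℝ) < n.factorial := by positivity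
    rw [coeff_derivative_treeSeries, div_le_iff₀ hn] at this
    linarith
  · have := congrArg (coeff (n + 1)) hE2
    rw [coeff_one_sub_two_X_mul, map_add, coeff_C, if_neg (by omega), hP, treeSeries, coeff_mk,
      Nat.factorial_succ] at this
    have hn : (n.factorial : ℝ) ≠ 0 := by positivity
    dsimp only
    rw [Nat.factorial_succ]
    push_cast at this ⊢
    field_simp at this
    linear_combination this

/-- The quantity u + 1 grows by at most the factor 1 + δ ≤ exp δ at each step. -/
theorem bounded_of_recurrence {u δ : ℕ → ℝ} (hδ : ∀ n, 0 ≤ δ n) (hs : Summable δ)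
    (hu0 : ∀ n, 0 ≤ u n) (hu : ∀ n, u (n + 1) ≤ u n * (1 + δ n) + δ n) :
    ∃ K, ∀ n, u n ≤ K := by
  have key : ∀ n, u n + 1 ≤ (u 0 + 1) * Real.exp (∑ i ∈ Finset.range n, δ i) := by
    intro n
    induction n with
    | zero => simp
    | succ n ih =>
      rw [Finset.sum_range_succ, Real.exp_add, ← mul_assoc]
      calc u (n + 1) + 1 ≤ (u n + 1) * (δ n + 1) := by linarith [hu n]
        _ ≤ _ := mul_le_mul ih (Real.add_one_le_exp _) (by linarith [hδ n])
          (mul_nonneg (by linarith [hu0 0]) (Real.exp_pos _).le)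
  refine ⟨(u 0 + 1) * Real.exp (∑' i, δ i), fun n => ?_⟩
  have h1 : Real.exp (∑ i ∈ Finset.range n, δ i) ≤ Real.exp (∑' i, δ i) :=
    Real.exp_le_exp.2 (hs.sum_le_tsum _ fun i _ => hδ i)
  have h2 := mul_le_mul_of_nonneg_left h1 (by linarith [hu0 0] : 0 ≤ u 0 + 1)
  linarith [key n]

theorem exists_treeSum_properDeviation_sq_le (k : ℕ) : ∃ K : ℝ, 0 ≤ K ∧ ∀ n,
    treeSum (fun t => properDeviation k t ^ 2) (n + 1) ≤ K * ((2 * n + 1) * treeNum (n + 1)) := by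
  obtain ⟨e, he, hrec⟩ := exists_recurrence_bound k
  have hY0 : ∀ n, 0 ≤ treeSum (fun t => properDeviation k t ^ 2) n :=
    treeSum_nonneg fun t => sq_nonneg _
  have hsum : Summable fun n : ℕ => 1 / (((n + 1 : ℕ) : ℝ) * √((n + 1 : ℕ) : ℝ)) := by
    have h : Summable fun n : ℕ => 1 / ((n : ℝ) ^ (3 / 2 : ℝ)) :=
      Real.summable_one_div_nat_rpow.2 (by norm_num)
    refine ((summable_nat_add_iff 1).2 h).congr fun n => ?_
    have hn : (0 : ℝ) < (n + 1 : ℕ) := by positivity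
    rw [Real.sqrt_eq_rpow, show (3 / 2 : ℝ) = 1 + 1 / 2 by norm_num, Real.rpow_add hn,
      Real.rpow_one]
  -- With m = n + 1, dividing by `treeNum (n + 2)` absorbs the growth factor 2m + 1. The errors left
  -- are of the summable order m^(-3/2).
  have hstep : ∀ n, e (n + 1) / treeNum (n + 1 + 2) ≤ e n / treeNum (n + 2) *
      (1 + 1 / (((n + 1 : ℕ) : ℝ) * √((n + 1 : ℕ) : ℝ))) +
        1 / (((n + 1 : ℕ) : ℝ) * √((n + 1 : ℕ) : ℝ)) := by
    intro n
    have hm : (1 : ℝ) ≤ (n + 1 : ℕ) := by norm_num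
    set m : ℝ := ((n + 1 : ℕ) : ℝ) with hmdef
    have hn : (n : ℝ) = m - 1 := by rw [hmdef]; push_cast; ring
    set s := √m with hs
    have hs1 : 1 ≤ s := Real.one_le_sqrt.2 hm
    have hss : s * s = m := Real.mul_self_sqrt (by linarith)
    -- The root indicator is split off by a weighted AM-GM inequality. The weight s = √m balances
    -- the relative loss 1/s in the square against the additive cost s.
    have hP : treeSum (fun t => deviation k t ^ 2) (n + 1) ≤
        (1 + 1 / s) * e n + (1 + s) * treeNum (n + 1) := by
      have h1 : treeSum (fun t => deviation k t ^ 2) (n + 1) ≤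
          treeSum (fun t => (1 + 1 / s) * properDeviation k t ^ 2 + (1 + s) * 1) (n + 1) := by
        refine treeSum_mono (fun t => ?_) _
        rw [deviation_eq]
        have hI : rankInd k t ^ 2 ≤ 1 :=
          pow_le_one₀ (rankInd_nonneg k t) (rankInd_le_one k t)
        have hsq : 0 ≤ 1 / s * (properDeviation k t - s * rankInd k t) ^ 2 := by positivity
        have he : 1 / s * (properDeviation k t - s * rankInd k t) ^ 2 =
            1 / s * properDeviation k t ^ 2 - 2 * properDeviation k t * rankInd k t
              + s * rankInd k t ^ 2 := by
          field_simp
          ring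
        nlinarith
      rw [treeSum_add, treeSum_const_mul, treeSum_const_mul] at h1
      refine h1.trans (add_le_add (mul_le_mul_of_nonneg_left (he n) (by positivity)) le_rfl)
    have ht1 := treeNum_pos (n + 1) (by omega)
    have ht2 := treeNum_pos (n + 2) (by omega)
    have ht3 : treeNum (n + 1 + 2) = (2 * m + 1) * treeNum (n + 2) := treeNum_succ_succ (n + 1)
    have ht4 : treeNum (n + 2) = (2 * m - 1) * treeNum (n + 1) := by
      rw [treeNum_succ_succ, hn]; ring
    have he0 : 0 ≤ e n := (hY0 _).trans (he n)
    rw [div_le_iff₀ (by rw [ht3]; positivity), ht3, hrec]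
    have e1 : (e n / treeNum (n + 2) * (1 + 1 / (m * s)) + 1 / (m * s)) *
        ((2 * m + 1) * treeNum (n + 2)) = (1 + 1 / (m * s)) * (2 * m + 1) * e n +
          (2 * m + 1) * (2 * m - 1) / (m * s) * treeNum (n + 1) := by
      rw [ht4]
      have : (2 * m - 1) ≠ 0 := by linarith
      field_simp
    rw [e1]
    have e2 : 2 * m + 1 + 1 / s ≤ (1 + 1 / (m * s)) * (2 * m + 1) := by
      have : (1 + 1 / (m * s)) * (2 * m + 1) = 2 * m + 1 + 1 / s + 1 / s + 1 / (m * s) := by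
        field_simp
        ring
      rw [this]
      have : 0 ≤ 1 / s + 1 / (m * s) := by positivity
      linarith
    have e3 : 1 + s ≤ (2 * m + 1) * (2 * m - 1) / (m * s) := by
      rw [le_div_iff₀ (by positivity)]
      have : s * m ≤ m * m := mul_le_mul_of_nonneg_right (by nlinarith) (by linarith)
      nlinarith
    have e4 := mul_le_mul_of_nonneg_right e2 he0
    have e5 := mul_le_mul_of_nonneg_right e3 ht1.le
    have e6 : 2 * ((n : ℝ) + 1) = 2 * m := by rw [hn]; ring
    rw [e6]
    linarith
  obtain ⟨K, hK⟩ := bounded_of_recurrence (u := fun n => e n / treeNum (n + 2))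
    (fun n => by positivity) hsum
    (fun n => div_nonneg ((hY0 _).trans (he n)) (treeNum_nonneg _)) hstep
  refine ⟨max K 0, le_max_right _ _, fun n => (he n).trans ?_⟩
  have := hK n
  rw [div_le_iff₀ (treeNum_pos _ (by omega)), treeNum_succ_succ] at this
  refine this.trans (mul_le_mul_of_nonneg_right (le_max_left _ _) ?_)
  have := treeNum_nonneg (n + 1)
  positivity

/-- The variance of the number of vertices of rank `k` grows at most linearly. -/
theorem exists_treeSum_deviation_sq_le (k : ℕ) : ∃ K : ℝ, 0 ≤ K ∧ ∀ n,
    treeSum (fun t => deviation k t ^ 2) n ≤ K * (n * treeNum n) := by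
  obtain ⟨K, hK0, hK⟩ := exists_treeSum_properDeviation_sq_le k
  refine ⟨4 * K + 2, by positivity, fun n => ?_⟩
  rcases n with _ | n
  · simp [treeSum_zero]
  have h1 : treeSum (fun t => deviation k t ^ 2) (n + 1) ≤
      treeSum (fun t => 2 * properDeviation k t ^ 2 + 2 * 1) (n + 1) := by
    refine treeSum_mono (fun t => ?_) _
    rw [deviation_eq]
    have hI : rankInd k t ^ 2 ≤ 1 := pow_le_one₀ (rankInd_nonneg k t) (rankInd_le_one k t)
    nlinarith [sq_nonneg (properDeviation k t - rankInd k t)]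
  rw [treeSum_add, treeSum_const_mul, treeSum_const_mul] at h1
  have h2 := hK n
  have ht := treeNum_nonneg (n + 1)
  change _ ≤ _ + 2 * treeNum (n + 1) at h1
  push_cast
  have hn : (0 : ℝ) ≤ n := by positivity
  have h3 : 0 ≤ K * treeNum (n + 1) := by positivity
  have h4 : 0 ≤ n * treeNum (n + 1) := by positivity
  nlinarith

/-! ### Identification of the density with the integral. -/

theorem rootRankCount_eq (k n : ℕ) : (rootRankCount k n : ℝ) = treeSum (rankInd k) n := by
  classical
  have : {t | t ∈ increasingTrees (Finset.Icc 1 n) ∧ t.rootRank = k} =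
      ((treeFinset (Finset.Icc 1 n)).filter fun t => t.rootRank = k : Finset PlaneTree) := by
    ext t
    simp [mem_treeFinset]
  rw [rootRankCount, this, Set.ncard_coe_finset, Finset.card_filter, treeSum]
  push_cast
  refine Finset.sum_congr rfl fun t _ => ?_
  rw [rankInd]

theorem treeNum_le (n : ℕ) : treeNum n ≤ 2 ^ n * n.factorial := by
  induction n with
  | zero => simp [treeNum_zero]
  | succ n ih =>
    rcases Nat.eq_zero_or_pos n with rfl | hn
    · simp [treeNum_one]
    · rw [treeNum_succ n hn, Nat.factorial_succ, pow_succ]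
      push_cast
      calc (2 * (n : ℝ) - 1) * treeNum n ≤ (2 * (n + 1)) * treeNum n :=
            mul_le_mul_of_nonneg_right (by linarith) (treeNum_nonneg n)
        _ ≤ (2 * (n + 1)) * (2 ^ n * n.factorial) :=
            mul_le_mul_of_nonneg_left ih (by positivity)
        _ = _ := by ring

theorem treeSum_rankInd_div_factorial_le (k n : ℕ) :
    treeSum (rankInd k) n / n.factorial ≤ 2 ^ n := by
  rw [div_le_iff₀ (by positivity)]
  exact (treeSum_mono (rankInd_le_one k) n).trans (treeNum_le n)

theorem treeSum_rankInd_div_factorial_nonneg (k n : ℕ) :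
    0 ≤ treeSum (rankInd k) n / n.factorial :=
  div_nonneg (treeSum_nonneg (rankInd_nonneg k) n) (by positivity)

theorem deriv_rootRankEGF (k : ℕ) {z : ℝ} (hz0 : 0 ≤ z) (hz : z < 1 / 2) :
    deriv (rootRankEGF k) z = ∑' n : ℕ, treeSum (rankInd k) (n + 1) / n.factorial * z ^ n := by
  obtain ⟨ρ, hzρ, hρ⟩ := exists_between hz
  have hρ0 : 0 < ρ := hz0.trans_lt hzρ
  set a : ℕ → ℝ := fun n => treeSum (rankInd k) n / n.factorial with ha
  -- Termwise differentiation on the ball of radius ρ < 1/2: the coefficients are at most 2ⁿ, so the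
  -- differentiated terms are dominated by n 2ⁿ ρ^(n-1).
  have hu : Summable fun n : ℕ => (n : ℝ) * (2 * ρ) ^ n / ρ := by
    refine Summable.div_const ?_ _
    have := summable_pow_mul_geometric_of_norm_lt_one (R := ℝ) 1 (r := 2 * ρ)
      (by rw [Real.norm_eq_abs, abs_of_nonneg (by positivity)]; linarith)
    simpa using this
  have hd : HasDerivAt (fun z => ∑' n : ℕ, a n * z ^ n) (∑' n : ℕ, a n * (n * z ^ (n - 1))) z := by
    refine hasDerivAt_tsum_of_isPreconnected (g := fun n z => a n * z ^ n)
      (g' := fun n z => a n * (n * z ^ (n - 1))) hu (Metric.isOpen_ball (x := (0 : ℝ)) (ε := ρ))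
      (convex_ball _ _).isPreconnected (fun n y _ => ?_) (fun n y hy => ?_)
      (Metric.mem_ball_self hρ0) ?_ ?_
    · exact (hasDerivAt_pow n y).const_mul (a n)
    · rw [Metric.mem_ball, dist_zero_right] at hy
      rw [norm_mul, norm_mul, norm_pow, Real.norm_eq_abs (a n),
        abs_of_nonneg (treeSum_rankInd_div_factorial_nonneg k n), Real.norm_natCast]
      rcases n with _ | n
      · simp
      · have h1 : ‖y‖ ^ n ≤ ρ ^ n := pow_le_pow_left₀ (norm_nonneg _) hy.le n
        have h2 := treeSum_rankInd_div_factorial_le k (n + 1)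
        calc a (n + 1) * (((n + 1 : ℕ) : ℝ) * ‖y‖ ^ n)
            ≤ 2 ^ (n + 1) * (((n + 1 : ℕ) : ℝ) * ρ ^ n) := by
              refine mul_le_mul h2 ?_ (by positivity) (by positivity)
              exact mul_le_mul_of_nonneg_left h1 (by positivity)
          _ = _ := by
              rw [mul_pow]
              field_simp
              ring
    · refine summable_of_ne_finset_zero (s := {0}) fun n hn => ?_
      rw [Finset.mem_singleton] at hn
      simp [hn]
    · rw [Metric.mem_ball, dist_zero_right, Real.norm_eq_abs, abs_of_nonneg hz0]
      exact hzρ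
  have hE : rootRankEGF k = fun z => ∑' n : ℕ, a n * z ^ n := by
    funext z
    rw [rootRankEGF]
    refine tsum_congr fun n => ?_
    rw [rootRankCount_eq, ha]
    ring
  rw [hE, hd.deriv]
  have hs : Summable fun n : ℕ => a n * (n * z ^ (n - 1)) := by
    refine Summable.of_nonneg_of_le (fun n => ?_) (fun n => ?_) hu
    · have := treeSum_rankInd_div_factorial_nonneg k n
      positivity
    · rcases n with _ | n
      · simp
      · have h1 : z ^ n ≤ ρ ^ n := pow_le_pow_left₀ hz0 hzρ.le n
        have h2 := treeSum_rankInd_div_factorial_le k (n + 1)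
        calc a (n + 1) * (((n + 1 : ℕ) : ℝ) * z ^ n)
            ≤ 2 ^ (n + 1) * (((n + 1 : ℕ) : ℝ) * ρ ^ n) := by
              refine mul_le_mul h2 ?_ (by positivity) (by positivity)
              exact mul_le_mul_of_nonneg_left h1 (by positivity)
          _ = _ := by
              rw [mul_pow]
              field_simp
              ring
  rw [hs.tsum_eq_zero_add]
  simp only [Nat.cast_zero, zero_mul, mul_zero, zero_add, Nat.add_sub_cancel]
  refine tsum_congr fun n => ?_
  rw [ha]
  dsimp only
  rw [Nat.factorial_succ]
  have : (n.factorial : ℝ) ≠ 0 := by positivity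
  push_cast
  field_simp

theorem integral_pow_mul_sqrt_zero : ∫ x in (0 : ℝ)..(1 / 2), x ^ 0 * √(1 - 2 * x) = 1 / 3 := by
  have h := intervalIntegral.integral_eq_sub_of_hasDerivAt_of_le (a := 0) (b := 1 / 2)
    (f := fun x : ℝ => (1 - 2 * x) * √(1 - 2 * x)) (f' := fun x => -3 * (x ^ 0 * √(1 - 2 * x)))
    (by norm_num) (Continuous.continuousOn (by fun_prop)) (fun x hx => ?_)
    (Continuous.intervalIntegrable (by fun_prop) _ _)
  · rw [intervalIntegral.integral_const_mul] at h
    norm_num at h ⊢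
    linarith
  · have hpos : 0 < 1 - 2 * x := by linarith [hx.2]
    have h1 : HasDerivAt (fun x : ℝ => 1 - 2 * x) (-2) x := by
      simpa using ((hasDerivAt_id x).const_mul 2).const_sub 1
    refine (h1.mul (h1.sqrt hpos.ne')).congr_deriv ?_
    have hs : √(1 - 2 * x) ≠ 0 := (Real.sqrt_pos.2 hpos).ne'
    have hss := Real.mul_self_sqrt hpos.le
    field_simp
    nlinarith

/-- The function x^(n+1) (1 - 2x)^(3/2) vanishes at both endpoints, so its derivative integrates to
0. -/
theorem integral_pow_mul_sqrt_succ (n : ℕ) :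
    (2 * n + 5) * ∫ x in (0 : ℝ)..(1 / 2), x ^ (n + 1) * √(1 - 2 * x) =
      (n + 1) * ∫ x in (0 : ℝ)..(1 / 2), x ^ n * √(1 - 2 * x) := by
  have hi : ∀ m : ℕ, IntervalIntegrable (fun x : ℝ => x ^ m * √(1 - 2 * x))
      MeasureTheory.volume 0 (1 / 2) := fun m => Continuous.intervalIntegrable (by fun_prop) _ _
  have h := intervalIntegral.integral_eq_sub_of_hasDerivAt_of_le (a := 0) (b := 1 / 2)
    (f := fun x : ℝ => x ^ (n + 1) * ((1 - 2 * x) * √(1 - 2 * x)))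
    (f' := fun x => (n + 1) * (x ^ n * √(1 - 2 * x)) -
      (2 * n + 5) * (x ^ (n + 1) * √(1 - 2 * x)))
    (by norm_num) (Continuous.continuousOn (by fun_prop)) (fun x hx => ?_)
    (Continuous.intervalIntegrable (by fun_prop) _ _)
  · rw [intervalIntegral.integral_sub ((hi _).const_mul _) ((hi _).const_mul _),
      intervalIntegral.integral_const_mul, intervalIntegral.integral_const_mul] at h
    norm_num at h ⊢
    linarith
  · have hpos : 0 < 1 - 2 * x := by linarith [hx.2]
    have h1 : HasDerivAt (fun x : ℝ => 1 - 2 * x) (-2) x := by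
      simpa using ((hasDerivAt_id x).const_mul 2).const_sub 1
    refine ((hasDerivAt_pow (n + 1) x).mul (h1.mul (h1.sqrt hpos.ne'))).congr_deriv ?_
    have hs : √(1 - 2 * x) ≠ 0 := (Real.sqrt_pos.2 hpos).ne'
    have hss := Real.sq_sqrt hpos.le
    simp only [Pi.mul_apply, Nat.add_sub_cancel]
    set y := √(1 - 2 * x)
    rw [← hss, show x = (1 - y ^ 2) / 2 by linarith]
    push_cast
    field_simp
    ring

/-- This Beta integral produces exactly the denominators of `fringeWeight`. -/
theorem treeNum_mul_integral (n : ℕ) :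
    treeNum (n + 1) / n.factorial * ∫ x in (0 : ℝ)..(1 / 2), x ^ n * √(1 - 2 * x) =
      1 / ((2 * n + 1) * (2 * n + 3)) := by
  induction n with
  | zero => rw [integral_pow_mul_sqrt_zero, treeNum_one]; norm_num
  | succ n ih =>
    have h := integral_pow_mul_sqrt_succ n
    rw [treeNum_succ_succ, Nat.factorial_succ]
    set I := ∫ x in (0 : ℝ)..(1 / 2), x ^ n * √(1 - 2 * x)
    set J := ∫ x in (0 : ℝ)..(1 / 2), x ^ (n + 1) * √(1 - 2 * x)
    have hJ : J = (n + 1) / (2 * n + 5) * I := by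
      field_simp
      linarith
    rw [hJ]
    push_cast
    have e : (2 * (n : ℝ) + 1) * treeNum (n + 1) / ((n + 1) * n.factorial) *
        ((n + 1) / (2 * n + 5) * I) =
        (2 * n + 1) / (2 * n + 5) * (treeNum (n + 1) / n.factorial * I) := by
      field_simp
    rw [e, ih]
    field_simp
    ring

theorem rankLimit_eq (k : ℕ) : rankLimit k = rankDensity k := by
  rw [rankLimit, rankDensity]
  congr 1
  -- The series for the derivative is available only for z < 1/2, so the endpoint is discarded as a
  -- null set.
  rw [intervalIntegral.integral_of_le (by norm_num), MeasureTheory.integral_Ioc_eq_integral_Ioo]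
  set F : ℕ → ℝ → ℝ := fun n x =>
    treeSum (rankInd k) (n + 1) / n.factorial * (x ^ n * √(1 - 2 * x)) with hF
  have hF0 : ∀ n, 0 ≤ treeSum (rankInd k) (n + 1) / (n.factorial : ℝ) := fun n =>
    div_nonneg (treeSum_nonneg (rankInd_nonneg k) _) (by positivity)
  have hval : ∀ n, ∫ x in Set.Ioo (0 : ℝ) (1 / 2), F n x = fringeWeight k n := by
    intro n
    rw [← MeasureTheory.integral_Ioc_eq_integral_Ioo,
      ← intervalIntegral.integral_of_le (by norm_num), hF, intervalIntegral.integral_const_mul,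
      fringeWeight, rootProb, ← mul_one_div (treeSum _ _ / _), ← treeNum_mul_integral n]
    have := (treeNum_pos (n + 1) (by omega)).ne'
    field_simp
  have hnorm : ∀ n, ∫ x in Set.Ioo (0 : ℝ) (1 / 2), ‖F n x‖ = fringeWeight k n := by
    intro n
    rw [← hval n]
    refine MeasureTheory.setIntegral_congr_fun measurableSet_Ioo fun x hx => ?_
    refine Real.norm_of_nonneg (mul_nonneg (hF0 n) ?_)
    have := hx.1.le
    positivity
  have hint : ∀ n, MeasureTheory.Integrable (F n)
      (MeasureTheory.volume.restrict (Set.Ioo (0 : ℝ) (1 / 2))) := by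
    intro n
    have hc : Continuous (F n) := by rw [hF]; fun_prop
    exact (hc.integrableOn_Icc (a := 0) (b := 1 / 2)).mono_set Set.Ioo_subset_Icc_self
  have hsum := MeasureTheory.hasSum_integral_of_summable_integral_norm hint
    (by simp_rw [hnorm]; exact summable_fringeWeight k)
  simp_rw [hval] at hsum
  rw [hsum.tsum_eq]
  refine MeasureTheory.setIntegral_congr_fun measurableSet_Ioo fun x hx => ?_
  rw [deriv_rootRankEGF k hx.1.le hx.2, ← tsum_mul_left]
  refine tsum_congr fun n => ?_
  rw [hF]
  ring

/-! ### The limits form a positive probability law. -/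

theorem hasSum_rootProb (n : ℕ) (hn : 1 ≤ n) : HasSum (fun k => rootProb k n) 1 := by
  have h : HasSum (fun k => treeSum (rankInd k) n) (treeNum n) := by
    refine hasSum_sum fun t _ => ?_
    have := hasSum_ite_eq (β := ℕ) t.rootRank (1 : ℝ)
    refine this.congr_fun fun k => ?_
    simp only [rankInd, eq_comm]
  have := h.div_const (treeNum n)
  rwa [div_self (treeNum_pos n hn).ne'] at this

/-- The double series of fringe weights is nonnegative, so it may be summed over k first: root
probabilities sum to 1, and the remaining series has sum 1/2. -/
theorem hasSum_rankDensity : HasSum rankDensity 1 := by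
  have h1 : ∀ i, HasSum (fun k => fringeWeight k i) (1 / ((2 * i + 1) * (2 * i + 3))) :=
    fun i => (hasSum_rootProb (i + 1) (by omega)).div_const _
  have hs : Summable fun p : ℕ × ℕ => fringeWeight p.2 p.1 := by
    rw [summable_prod_of_nonneg fun p => fringeWeight_nonneg _ _]
    refine ⟨fun i => (h1 i).summable, ?_⟩
    simp_rw [(h1 _).tsum_eq]
    exact hasSum_inv_odd_mul.summable
  have h2 := (hs.hasSum.prod_fiberwise h1).unique hasSum_inv_odd_mul
  have h3 : HasSum (fun p : ℕ × ℕ => fringeWeight p.1 p.2) (1 / 2) := by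
    rw [← h2]
    exact ((Equiv.prodComm ℕ ℕ).hasSum_iff (f := fun p : ℕ × ℕ => fringeWeight p.2 p.1)).2
      hs.hasSum
  have h4 := (h3.prod_fiberwise fun k => (summable_fringeWeight k).hasSum).mul_left 2
  norm_num at h4
  exact h4

/-- A path on k + 1 vertices has its only leaf at depth k; this makes one fringe weight, and hence
every limit, positive. -/
theorem exists_tree_of_rank (k a : ℕ) : ∃ t ∈ increasingTrees (Finset.Icc a (a + k)),
    ∀ d, t.HasLeafAtDepth d ↔ d = k := by
  induction k generalizing a with
  | zero =>
    refine ⟨node a [], ?_, fun d => ⟨fun h => ?_, fun h => ?_⟩⟩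
    · have := (mem_increasingTrees_insert (s := a) (V := ∅) (by simp) (node a [])).2
        (Or.inl ⟨rfl, rfl⟩)
      simpa using this
    · cases h with
      | leaf => rfl
      | step _ _ s d hs => simp at hs
    · rw [h]; exact .leaf a
  | succ k ih =>
    obtain ⟨L, hL, hd⟩ := ih (a + 1)
    have hV : Finset.Icc a (a + (k + 1)) = insert a (Finset.Icc (a + 1) (a + 1 + k)) := by
      ext x
      simp only [Finset.mem_Icc, Finset.mem_insert]
      omega
    refine ⟨node a [L], ?_, fun d => ⟨fun h => ?_, fun h => ?_⟩⟩
    · rw [hV, mem_increasingTrees_insert (fun v hv => by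
        rw [Finset.mem_Icc] at hv; omega)]
      refine Or.inr ⟨_, subset_rfl, L, hL, node a [], ?_, rfl⟩
      rw [Finset.sdiff_self]
      exact (mem_increasingTrees_insert (by simp) _).2 (Or.inl ⟨rfl, rfl⟩)
    · cases h with
      | step _ _ s d hs h =>
        rw [List.mem_singleton] at hs
        subst hs
        rw [(hd d).1 h]
    · rw [h]
      exact .step a _ L k (by simp) ((hd k).2 rfl)

theorem rankDensity_pos (k : ℕ) : 0 < rankDensity k := by
  refine mul_pos (by norm_num)
    ((summable_fringeWeight k).tsum_pos (fringeWeight_nonneg k) k ?_)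
  refine div_pos (div_pos ?_ (treeNum_pos _ (by omega))) (by positivity)
  obtain ⟨t, ht, hd⟩ := exists_tree_of_rank k 1
  rw [add_comm 1 k] at ht
  refine Finset.sum_pos' (fun t _ => rankInd_nonneg k t) ⟨t, mem_treeFinset.2 ht, ?_⟩
  have : t.rootRank = k := by
    rw [rootRank]
    simp_rw [hd]
    simp
  rw [rankInd, if_pos this]
  norm_num

/-! ### Ranks of labelled vertices and tuples of distinct vertices. -/

theorem vertexRank_label {t s : PlaneTree} (ht : t.labels.Nodup) (hs : s ∈ t.subtrees) :
    t.vertexRank s.label = s.rootRank := by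
  have : {k : ℕ | ∃ u ∈ t.subtrees, u.label = s.label ∧ u.rootRank = k} = {s.rootRank} := by
    ext k
    simp only [Set.mem_ofPred_eq, Set.mem_singleton_iff]
    constructor
    · rintro ⟨u, hu, hl, rfl⟩
      rw [List.inj_on_of_nodup_map ht hu hs hl]
    · rintro rfl
      exact ⟨s, hs, rfl, rfl⟩
  rw [vertexRank, this, csInf_singleton]

theorem rankCount_eq_card {S : Finset ℕ} {t : PlaneTree} (ht : t ∈ increasingTrees S) (k : ℕ) :
    rankCount k t = (S.filter fun v => t.vertexRank v = k).card := by
  have h1 : t.labels.toFinset = S := by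
    ext x
    rw [List.mem_toFinset, ht.2.1]
  rw [← h1, Finset.card_filter]
  push_cast
  rw [List.sum_toFinset _ ht.1, labels, List.map_map, rankCount]
  congr 1
  refine List.map_congr_left fun s hs => ?_
  rw [Function.comp_apply, vertexRank_label ht.1 hs, rankInd]

/-- The ordered `r`-tuples of distinct elements of `{1, …, n}`. -/
def distinctTuples (r n : ℕ) : Finset (Fin r → ℕ) :=
  (Fintype.piFinset fun _ => Finset.Icc 1 n).filter Function.Injective

theorem card_distinctTuples (r n : ℕ) : (distinctTuples r n).card = n.descFactorial r := by
  have e : {f // f ∈ distinctTuples r n} ≃ (Fin r ↪ Finset.Icc 1 n) :=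
    { toFun := fun f => ⟨fun j => ⟨f.1 j, by
          have := (Finset.mem_filter.1 f.2).1
          rw [Fintype.mem_piFinset] at this
          exact this j⟩, fun i j h => (Finset.mem_filter.1 f.2).2 (Subtype.ext_iff.1 h)⟩
      invFun := fun g => ⟨fun j => g j, by
          rw [distinctTuples, Finset.mem_filter, Fintype.mem_piFinset]
          exact ⟨fun j => (g j).2, fun i j h => g.injective (Subtype.ext h)⟩⟩
      left_inv := fun f => rfl
      right_inv := fun g => rfl }
  rw [← Fintype.card_coe, Fintype.card_congr e, Fintype.card_embedding_eq]
  simp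

/-- The first bound, from Bernoulli's inequality, measures the loss from excluding repetitions; the
second lets the falling factorial serve as denominator in place of the power. -/
theorem le_descFactorial {r n : ℕ} (hr : 1 ≤ r) (hn : r ≤ n) :
    (n : ℝ) ^ r * (1 - r ^ 2 / n) ≤ n.descFactorial r ∧
      (n : ℝ) ^ r ≤ r ^ r * n.descFactorial r := by
  have hr' : (1 : ℝ) ≤ r := by exact_mod_cast hr
  have hn' : (r : ℝ) ≤ n := by exact_mod_cast hn
  have h0 : (0 : ℝ) < n := by linarith
  have h : ((n : ℝ) + 1 - r) ^ r ≤ n.descFactorial r := by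
    have := Nat.pow_sub_le_descFactorial n r
    have h' : (((n + 1 - r : ℕ) : ℝ)) ^ r ≤ n.descFactorial r := by exact_mod_cast this
    rw [Nat.cast_sub (by omega)] at h'
    simpa using h'
  constructor
  · refine le_trans ?_ h
    have hb : 1 + (r : ℝ) * (-((r - 1) / n)) ≤ (1 + -((r - 1) / n)) ^ r :=
      one_add_mul_le_pow (by
        have : ((r : ℝ) - 1) / n ≤ 1 := by rw [div_le_one h0]; linarith
        linarith) r
    have e : ((n : ℝ) + 1 - r) ^ r = n ^ r * (1 + -((r - 1) / n)) ^ r := by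
      rw [← mul_pow]
      congr 1
      field_simp
      ring
    rw [e]
    refine mul_le_mul_of_nonneg_left (le_trans ?_ hb) (by positivity)
    have : (r : ℝ) * ((r - 1) / n) ≤ r ^ 2 / n := by
      rw [← mul_div_assoc]
      refine div_le_div_of_nonneg_right ?_ h0.le
      nlinarith
    linarith
  · refine le_trans ?_ (mul_le_mul_of_nonneg_left h (by positivity))
    rw [← mul_pow]
    refine pow_le_pow_left₀ h0.le ?_ r
    nlinarith

/-! ### Mixed moments by first order expansion. -/

/-- First order expansion of a product of numbers in the unit interval. -/
theorem exists_prod_expansion {ι : Type*} [DecidableEq ι] (s : Finset ι) (c : ι → ℝ)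
    (hc : ∀ i, c i ∈ Set.Icc (0 : ℝ) 1) :
    ∃ d : ι → ℝ, ∃ C : ℝ, 0 ≤ C ∧ ∀ x : ι → ℝ, (∀ i, c i + x i ∈ Set.Icc (0 : ℝ) 1) →
      |∏ i ∈ s, (c i + x i) - ∏ i ∈ s, c i - ∑ i ∈ s, d i * x i| ≤ C * ∑ i ∈ s, x i ^ 2 ∧
      |∏ i ∈ s, (c i + x i) - ∏ i ∈ s, c i| ≤ ∑ i ∈ s, |x i| := by
  induction s using Finset.induction_on with
  | empty => exact ⟨0, 0, le_rfl, fun x _ => by simp⟩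
  | insert a s ha ih =>
    obtain ⟨d, C, hC, ih⟩ := ih
    -- Product rule for the coefficients. The new error is the product of x_a and the change of the
    -- old product; the Lipschitz bound is carried through the induction to control it.
    refine ⟨fun i => if i = a then ∏ i ∈ s, c i else c a * d i, C + s.card + 1, by positivity,
      fun x hx => ?_⟩
    obtain ⟨h1, h2⟩ := ih x hx
    have hsum : ∑ i ∈ s, (if i = a then ∏ i ∈ s, c i else c a * d i) * x i =
        c a * ∑ i ∈ s, d i * x i := by
      rw [Finset.mul_sum]
      refine Finset.sum_congr rfl fun i hi => ?_
      rw [if_neg (by rintro rfl; exact ha hi), mul_assoc]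
    rw [Finset.prod_insert ha, Finset.prod_insert ha, Finset.sum_insert ha, Finset.sum_insert ha,
      Finset.sum_insert ha]
    beta_reduce
    rw [if_pos rfl, hsum]
    have hP0 : 0 ≤ ∏ i ∈ s, (c i + x i) := Finset.prod_nonneg fun i _ => (hx i).1
    have hP1 : ∏ i ∈ s, (c i + x i) ≤ 1 :=
      Finset.prod_le_one (fun i _ => (hx i).1) fun i _ => (hx i).2
    set P := ∏ i ∈ s, (c i + x i)
    set p := ∏ i ∈ s, c i
    set l := ∑ i ∈ s, d i * x i
    have hca := hc a
    have hq : |x a| * ∑ i ∈ s, |x i| ≤ s.card * x a ^ 2 + ∑ i ∈ s, x i ^ 2 := by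
      rw [Finset.mul_sum, ← nsmul_eq_mul, ← Finset.sum_const, ← Finset.sum_add_distrib]
      refine Finset.sum_le_sum fun i _ => ?_
      rw [← sq_abs (x a), ← sq_abs (x i)]
      nlinarith [sq_nonneg (|x a| - |x i|), abs_nonneg (x a), abs_nonneg (x i)]
    have hQ : 0 ≤ ∑ i ∈ s, x i ^ 2 := Finset.sum_nonneg fun i _ => sq_nonneg _
    set Q := ∑ i ∈ s, x i ^ 2
    constructor
    · have e : (c a + x a) * P - c a * p - (p * x a + c a * l) =
          c a * (P - p - l) + x a * (P - p) := by ring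
      rw [e]
      refine (abs_add_le _ _).trans ?_
      rw [abs_mul, abs_mul, abs_of_nonneg hca.1]
      have h3 : c a * |P - p - l| ≤ C * Q :=
        (mul_le_of_le_one_left (abs_nonneg _) hca.2).trans h1
      have h4 : |x a| * |P - p| ≤ s.card * x a ^ 2 + Q :=
        (mul_le_mul_of_nonneg_left h2 (abs_nonneg _)).trans hq
      have h5 : 0 ≤ (C + 1) * x a ^ 2 := by positivity
      have h6 : 0 ≤ s.card * Q := by positivity
      nlinarith
    · have e : (c a + x a) * P - c a * p = x a * P + c a * (P - p) := by ring
      rw [e]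
      refine (abs_add_le _ _).trans ?_
      rw [abs_mul, abs_mul, abs_of_nonneg hca.1, abs_of_nonneg hP0]
      exact add_le_add (mul_le_of_le_one_right (abs_nonneg _) hP1)
        ((mul_le_of_le_one_left (abs_nonneg _) hca.2).trans h2)

theorem rankCount_mem_Icc {n : ℕ} {t : PlaneTree} (ht : t ∈ treeFinset (Finset.Icc 1 n))
    (k : ℕ) : 0 ≤ rankCount k t ∧ rankCount k t ≤ n := by
  rw [rankCount_eq_card (mem_treeFinset.1 ht)]
  refine ⟨by positivity, ?_⟩
  have := Finset.card_filter_le (Finset.Icc 1 n) fun v => t.vertexRank v = k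
  rw [Nat.card_Icc, Nat.add_sub_cancel] at this
  exact_mod_cast this

/-- The mixed moments of the numbers of vertices of given ranks. -/
theorem exists_abs_sum_prod_rankCount_sub_le (r : ℕ) (k : Fin r → ℕ) : ∃ K : ℝ, 0 ≤ K ∧
    ∀ n : ℕ, 1 ≤ n → |treeSum (fun t => ∏ j, rankCount (k j) t) n -
      n ^ r * (treeNum n * ∏ j, rankDensity (k j))| ≤ n ^ r * (K * treeNum n / n) := by
  obtain ⟨d, C, hC, hexp⟩ := exists_prod_expansion Finset.univ (fun j => rankDensity (k j))
    fun j => ⟨rankDensity_nonneg _, rankDensity_le_one _⟩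
  choose V hV0 hV using exists_treeSum_deviation_sq_le
  have hVs : 0 ≤ ∑ j, V (k j) := Finset.sum_nonneg fun j _ => hV0 _
  have hds : 0 ≤ ∑ j, |d j| := Finset.sum_nonneg fun j _ => abs_nonneg _
  refine ⟨2 * ∑ j, |d j| + C * ∑ j, V (k j), by positivity, fun n hn => ?_⟩
  have hn0 : (0 : ℝ) < n := by exact_mod_cast hn
  have htn := treeNum_nonneg n
  set p := ∏ j, rankDensity (k j) with hp
  have e1 : treeSum (fun t => ∏ j, rankCount (k j) t) n - n ^ r * (treeNum n * p) =
      n ^ r * treeSum (fun t => ∏ j, (rankCount (k j) t / n) - p) n := by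
    rw [treeSum_sub, mul_sub, ← treeSum_const_mul]
    congr 1
    · congr 1
      funext t
      rw [Finset.prod_div_distrib, Finset.prod_const, Finset.card_univ, Fintype.card_fin]
      field_simp
    · have := treeSum_const_mul p (fun _ => 1) n
      simp only [mul_one] at this
      rw [this, treeNum]
      ring
  rw [e1, abs_mul, abs_of_nonneg (by positivity : (0 : ℝ) ≤ n ^ r)]
  refine mul_le_mul_of_nonneg_left ?_ (by positivity)
  have h1 : ∀ t ∈ treeFinset (Finset.Icc 1 n),
      |(∏ j, (rankCount (k j) t / n) - p) - ∑ j, d j * (deviation (k j) t / n)| ≤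
        C * ∑ j, (deviation (k j) t / n) ^ 2 := by
    intro t ht
    have hx : ∀ j, rankDensity (k j) + deviation (k j) t / n = rankCount (k j) t / n := by
      intro j
      rw [deviation, size_of_mem (mem_treeFinset.1 ht), Nat.card_Icc, Nat.add_sub_cancel]
      field_simp
      ring
    have := (hexp (fun j => deviation (k j) t / n) fun j => by
      rw [hx]
      have := rankCount_mem_Icc ht (k j)
      exact ⟨div_nonneg this.1 hn0.le, (div_le_one hn0).2 this.2⟩).1
    simp_rw [hx] at this
    exact this
  have h2 : |treeSum (fun t => ∏ j, (rankCount (k j) t / n) - p) n -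
      treeSum (fun t => ∑ j, d j * (deviation (k j) t / n)) n| ≤
      treeSum (fun t => C * ∑ j, (deviation (k j) t / n) ^ 2) n := by
    rw [← treeSum_sub]
    exact (Finset.abs_sum_le_sum_abs _ _).trans (Finset.sum_le_sum h1)
  -- The linear part is small only after summing over trees, by the bounded bias; a bound tree by
  -- tree would not give the order 1/n.
  have h3 : |treeSum (fun t => ∑ j, d j * (deviation (k j) t / n)) n| ≤
      (2 * ∑ j, |d j|) * treeNum n / n := by
    rw [treeSum, Finset.sum_comm, mul_assoc, Finset.sum_mul, Finset.mul_sum, Finset.sum_div]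
    refine (Finset.abs_sum_le_sum_abs _ _).trans (Finset.sum_le_sum fun j _ => ?_)
    rw [← Finset.mul_sum, ← Finset.sum_div, abs_mul, abs_div, abs_of_pos hn0, ← mul_div_assoc]
    refine div_le_div_of_nonneg_right ?_ hn0.le
    have := mul_le_mul_of_nonneg_left (abs_treeSum_deviation_le (k j) n) (abs_nonneg (d j))
    rw [treeSum] at this
    linarith
  have h4 : treeSum (fun t => C * ∑ j, (deviation (k j) t / n) ^ 2) n ≤
      (C * ∑ j, V (k j)) * treeNum n / n := by
    rw [treeSum_const_mul, treeSum, Finset.sum_comm, mul_assoc, mul_div_assoc]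
    refine mul_le_mul_of_nonneg_left ?_ hC
    rw [Finset.sum_mul, Finset.sum_div]
    refine Finset.sum_le_sum fun j _ => ?_
    have := hV (k j) n
    simp_rw [div_pow]
    rw [← Finset.sum_div, div_le_iff₀ (by positivity)]
    rw [treeSum] at this
    refine this.trans (le_of_eq ?_)
    field_simp
  have h5 := abs_le.1 h2
  have h6 := abs_le.1 h3
  rw [add_mul, add_div]
  rw [abs_le]
  constructor <;> linarith [h5.1, h5.2, h6.1, h6.2]

/-! ### Sampling without replacement. -/

open scoped Classical in
/-- The outcomes for which the tuple of ranks lies in `S`. -/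
noncomputable def rankEvent (r n : ℕ) (S : Set (Fin r → ℕ)) :
    Finset (PlaneTree × (Fin r → ℕ)) :=
  (treeFinset (Finset.Icc 1 n) ×ˢ distinctTuples r n).filter
    fun ω => (fun j => ω.1.vertexRank (ω.2 j)) ∈ S

theorem treeNum_eq_card (n : ℕ) : treeNum n = (treeFinset (Finset.Icc 1 n)).card := by
  simp [treeNum, treeSum]

theorem rankProb_eq (r n : ℕ) (S : Set (Fin r → ℕ)) :
    rankProb r n S = (rankEvent r n S).card / (treeNum n * n.descFactorial r) := by
  have h : rankSamples r n =
      (treeFinset (Finset.Icc 1 n) ×ˢ distinctTuples r n : Finset _) := by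
    ext ω
    rw [rankSamples, Set.mem_ofPred_eq, Finset.mem_coe, Finset.mem_product, mem_treeFinset,
      distinctTuples, Finset.mem_filter, Fintype.mem_piFinset]
    tauto
  have h' : {ω | ω ∈ rankSamples r n ∧ (fun j => ω.1.vertexRank (ω.2 j)) ∈ S} =
      (rankEvent r n S : Set (PlaneTree × (Fin r → ℕ))) := by
    ext ω
    rw [h, rankEvent, Finset.coe_filter]
    rfl
  rw [rankProb, h', Set.ncard_coe_finset, h, Set.ncard_coe_finset, Finset.card_product,
    card_distinctTuples, treeNum_eq_card]
  push_cast
  rfl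

/-- For each tree, the product of rank counts is the number of all tuples with the given ranks,
repetitions allowed. The discrepancy is at most the number of non-injective tuples. -/
theorem abs_card_rankEvent_sub_le {r n : ℕ} (hr : 1 ≤ r) (hn : r ≤ n) (k : Fin r → ℕ) :
    |(rankEvent r n {k}).card - treeSum (fun t => ∏ j, rankCount (k j) t) n| ≤
      n ^ r * (r ^ 2 * treeNum n / n) := by
  classical
  have hcard : ((rankEvent r n {k}).card : ℝ) = treeSum (fun t =>
      ((distinctTuples r n).filter fun ω => (fun j => t.vertexRank (ω j)) = k).card) n := by
    rw [rankEvent, Finset.card_filter, Finset.sum_product, treeSum]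
    push_cast
    refine Finset.sum_congr rfl fun t _ => ?_
    rw [Finset.card_filter]
    push_cast
    refine Finset.sum_congr rfl fun ω _ => ?_
    simp only [Set.mem_singleton_iff]
  rw [hcard, ← treeSum_sub]
  refine (Finset.abs_sum_le_sum_abs _ _).trans ?_
  have hrhs : (n : ℝ) ^ r * (r ^ 2 * treeNum n / n) =
      ∑ t ∈ treeFinset (Finset.Icc 1 n), (n : ℝ) ^ r * (r ^ 2 / n) := by
    rw [Finset.sum_const, nsmul_eq_mul, treeNum_eq_card]
    ring
  rw [hrhs]
  refine Finset.sum_le_sum fun t ht => ?_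
  set A := Fintype.piFinset fun _ : Fin r => Finset.Icc 1 n with hA
  have hprod : ∏ j, rankCount (k j) t =
      (A.filter fun ω => (fun j => t.vertexRank (ω j)) = k).card := by
    have : (A.filter fun ω => (fun j => t.vertexRank (ω j)) = k) =
        Fintype.piFinset fun j => (Finset.Icc 1 n).filter fun v => t.vertexRank v = k j := by
      ext ω
      simp only [hA, Finset.mem_filter, Fintype.mem_piFinset, funext_iff]
      exact forall_and.symm
    rw [this, Fintype.card_piFinset]
    push_cast
    exact Finset.prod_congr rfl fun j _ => rankCount_eq_card (mem_treeFinset.1 ht) _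
  rw [hprod]
  have hsub : (distinctTuples r n).filter (fun ω => (fun j => t.vertexRank (ω j)) = k) ⊆
      A.filter fun ω => (fun j => t.vertexRank (ω j)) = k :=
    Finset.filter_subset_filter _ (Finset.filter_subset _ _)
  have h1 := Finset.card_sdiff_add_card_eq_card hsub
  have h2 : (A.filter (fun ω => (fun j => t.vertexRank (ω j)) = k) \
      (distinctTuples r n).filter (fun ω => (fun j => t.vertexRank (ω j)) = k)).card ≤
      (A \ distinctTuples r n).card := by
    refine Finset.card_le_card fun ω hω => ?_
    simp only [Finset.mem_sdiff, Finset.mem_filter] at hω ⊢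
    tauto
  have hA' : distinctTuples r n ⊆ A := Finset.filter_subset _ _
  have h3 := Finset.card_sdiff_add_card_eq_card hA'
  have hAc : A.card = n ^ r := by simp [hA, Fintype.card_piFinset]
  rw [hAc, card_distinctTuples] at h3
  have h4 := (le_descFactorial hr hn).1
  have h1' : ((A.filter (fun ω => (fun j => t.vertexRank (ω j)) = k) \
      (distinctTuples r n).filter (fun ω => (fun j => t.vertexRank (ω j)) = k)).card : ℝ) +
      ((distinctTuples r n).filter (fun ω => (fun j => t.vertexRank (ω j)) = k)).card =
      (A.filter (fun ω => (fun j => t.vertexRank (ω j)) = k)).card := by exact_mod_cast h1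
  have h2' : ((A.filter (fun ω => (fun j => t.vertexRank (ω j)) = k) \
      (distinctTuples r n).filter (fun ω => (fun j => t.vertexRank (ω j)) = k)).card : ℝ) ≤
      (A \ distinctTuples r n).card := by exact_mod_cast h2
  have h3' : ((A \ distinctTuples r n).card : ℝ) + n.descFactorial r = n ^ r := by
    exact_mod_cast h3
  rw [abs_le]
  constructor <;> nlinarith

theorem exists_abs_rankProb_sub_le (r : ℕ) (hr : 1 ≤ r) (k : Fin r → ℕ) : ∃ C : ℝ, 0 ≤ C ∧
    ∀ n : ℕ, r ≤ n → |rankProb r n {k} - ∏ j, rankDensity (k j)| ≤ C / n := by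
  obtain ⟨K, hK0, hK⟩ := exists_abs_sum_prod_rankCount_sub_le r k
  refine ⟨r ^ r * (K + 2 * r ^ 2), by positivity, fun n hn => ?_⟩
  have hn0 : (0 : ℝ) < n := by exact_mod_cast hr.trans hn
  have ht := treeNum_pos n (hr.trans hn)
  have h1 := abs_card_rankEvent_sub_le hr hn k
  have h2 := hK n (hr.trans hn)
  obtain ⟨h3, h4⟩ := le_descFactorial hr hn
  have h5 : (n.descFactorial r : ℝ) ≤ n ^ r := by exact_mod_cast Nat.descFactorial_le_pow n r
  have hM : (0 : ℝ) < n.descFactorial r := by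
    exact_mod_cast Nat.pos_of_ne_zero (by rw [Ne, Nat.descFactorial_eq_zero_iff_lt]; omega)
  have hp0 : 0 ≤ ∏ j, rankDensity (k j) := Finset.prod_nonneg fun j _ => rankDensity_nonneg _
  have hp1 : ∏ j, rankDensity (k j) ≤ 1 :=
    Finset.prod_le_one (fun j _ => rankDensity_nonneg _) fun j _ => rankDensity_le_one _
  set p := ∏ j, rankDensity (k j)
  set M : ℝ := (n.descFactorial r : ℝ)
  set N : ℝ := ((rankEvent r n {k}).card : ℝ)
  -- The main term is renormalised from all tuples to tuples of distinct vertices, which costs the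
  -- same error again; hence the factor 2 in the constant.
  have h6 : |n ^ r * (treeNum n * p) - treeNum n * M * p| ≤ n ^ r * (r ^ 2 * treeNum n / n) := by
    have e : (n : ℝ) ^ r * (treeNum n * p) - treeNum n * M * p =
        p * (treeNum n * (n ^ r - M)) := by ring
    have hnn : 0 ≤ treeNum n * (n ^ r - M) := mul_nonneg ht.le (by linarith)
    rw [e, abs_of_nonneg (mul_nonneg hp0 hnn)]
    refine (mul_le_of_le_one_left hnn hp1).trans ?_
    have : (n : ℝ) ^ r - M ≤ n ^ r * (r ^ 2 / n) := by linarith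
    refine (mul_le_mul_of_nonneg_left this ht.le).trans (le_of_eq ?_)
    ring
  have h7 : |N - treeNum n * M * p| ≤ n ^ r * ((K + 2 * r ^ 2) * treeNum n / n) := by
    have e : (n : ℝ) ^ r * ((K + 2 * r ^ 2) * treeNum n / n) = n ^ r * (K * treeNum n / n) +
        2 * (n ^ r * (r ^ 2 * treeNum n / n)) := by ring
    rw [e]
    rw [abs_le] at h1 h2 h6 ⊢
    constructor <;> linarith [h1.1, h1.2, h2.1, h2.2, h6.1, h6.2]
  have htM : 0 < treeNum n * M := by positivity
  rw [rankProb_eq, show N / (treeNum n * M) - p = (N - treeNum n * M * p) / (treeNum n * M) by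
    field_simp, abs_div, abs_of_pos htM, div_le_iff₀ htM]
  refine h7.trans ((mul_le_mul_of_nonneg_right h4 (by positivity)).trans (le_of_eq ?_))
  ring

/-! ### From single tuples of ranks to arbitrary events. -/

theorem hasSum_pi_prod {f : ℕ → ℝ} (hf0 : ∀ k, 0 ≤ f k) (hf : HasSum f 1) (r : ℕ) :
    HasSum (fun k : Fin r → ℕ => ∏ j, f (k j)) 1 := by
  induction r with
  | zero => simp
  | succ r ih =>
    have hs : Summable fun p : ℕ × (Fin r → ℕ) => f p.1 * ∏ j, f (p.2 j) :=
      Summable.mul_of_nonneg (f := f) (g := fun k : Fin r → ℕ => ∏ j, f (k j)) hf.summable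
        ih.summable hf0 fun k => Finset.prod_nonneg fun j _ => hf0 _
    have h : HasSum (fun p : ℕ × (Fin r → ℕ) => f p.1 * ∏ j, f (p.2 j)) (1 * 1) :=
      HasSum.mul (f := f) (g := fun k : Fin r → ℕ => ∏ j, f (k j)) hf ih hs
    rw [← (Fin.consEquiv fun _ : Fin (r + 1) => ℕ).hasSum_iff]
    rw [one_mul] at h
    refine h.congr_fun fun p => ?_
    simp [Fin.prod_univ_succ, Fin.consEquiv]

/-- Pointwise convergence of probability weights to a probability law implies convergence of the
probabilities of all events. -/
theorem tendsto_prob_of_tendsto_singleton {ι : Type*} {P : ℕ → Set ι → ℝ} {p : ι → ℝ}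
    (hp : HasSum p 1) (hlim : ∀ k, Tendsto (fun n => P n {k}) atTop (𝓝 (p k)))
    (hsub : ∀ n (S : Set ι) (K : Finset S), ∑ k ∈ K, P n {k.1} ≤ P n S)
    (hcompl : ∀ᶠ n in atTop, ∀ S, P n S + P n Sᶜ = 1) (S : Set ι) :
    Tendsto (fun n => P n S) atTop (𝓝 (∑' k : S, p k.1)) := by
  -- A finite part of `S` already carries almost all of its limiting mass. Applied to the
  -- complement, the same lower bound yields the upper bound, since the total mass is 1.
  have lower : ∀ (S : Set ι) (a : ℝ), a < ∑' k : S, p k.1 → ∀ᶠ n in atTop, a < P n S := by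
    intro S a ha
    have hS := (hp.summable.subtype S).hasSum
    obtain ⟨K, hK⟩ := (hS.eventually (lt_mem_nhds ha)).exists
    have hKl : Tendsto (fun n => ∑ k ∈ K, P n {k.1}) atTop (𝓝 (∑ k ∈ K, p k.1)) :=
      tendsto_finsetSum _ fun k _ => hlim k.1
    filter_upwards [hKl.eventually (lt_mem_nhds hK)] with n hn
    exact hn.trans_le (hsub n S K)
  refine tendsto_order.2 ⟨lower S, fun b hb => ?_⟩
  have h1 : ∑' k : S, p k.1 + ∑' k : (Sᶜ : Set ι), p k.1 = 1 := by
    rw [← hp.tsum_eq]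
    exact hp.summable.tsum_subtype_add_tsum_subtype_compl S
  filter_upwards [lower Sᶜ (1 - b) (by linarith), hcompl] with n h2 h3
  linarith [h3 S]

theorem sum_rankProb_singleton_le {r n : ℕ} (S : Set (Fin r → ℕ)) (K : Finset S) :
    ∑ k ∈ K, rankProb r n {k.1} ≤ rankProb r n S := by
  classical
  simp_rw [rankProb_eq]
  rw [← Finset.sum_div]
  refine div_le_div_of_nonneg_right ?_ (mul_nonneg (treeNum_nonneg n) (by positivity))
  norm_cast
  rw [← Finset.card_biUnion]
  · refine Finset.card_le_card fun ω hω => ?_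
    simp only [rankEvent, Finset.mem_biUnion, Finset.mem_filter, Set.mem_singleton_iff] at hω ⊢
    obtain ⟨k, -, h1, h2⟩ := hω
    exact ⟨h1, h2 ▸ k.2⟩
  · intro k _ l _ hkl
    rw [Function.onFun, Finset.disjoint_left]
    intro ω h1 h2
    simp only [rankEvent, Finset.mem_filter, Set.mem_singleton_iff] at h1 h2
    exact hkl (Subtype.ext (h1.2.symm.trans h2.2))

theorem rankProb_add_compl {r n : ℕ} (hr : 1 ≤ r) (hn : r ≤ n) (S : Set (Fin r → ℕ)) :
    rankProb r n S + rankProb r n Sᶜ = 1 := by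
  classical
  have hM : (0 : ℝ) < n.descFactorial r := by
    exact_mod_cast Nat.pos_of_ne_zero (by rw [Ne, Nat.descFactorial_eq_zero_iff_lt]; omega)
  have ht := treeNum_pos n (hr.trans hn)
  have h : (rankEvent r n S).card + (rankEvent r n Sᶜ).card =
      (treeFinset (Finset.Icc 1 n) ×ˢ distinctTuples r n).card := by
    simp only [rankEvent, Set.mem_compl_iff]
    exact Finset.card_filter_add_card_filter_not _
  rw [Finset.card_product, card_distinctTuples] at h
  rw [rankProb_eq, rankProb_eq, ← add_div, div_eq_one_iff_eq (by positivity), treeNum_eq_card]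
  exact_mod_cast h

/-- The numbers `c_k = rankLimit k` are the weights of a probability law; the joint law of the
ranks satisfies the product formula with relative error `O(1 / n)`; and it converges to the law
of `r` independent variables with law `(c_k)`. -/
theorem corollary3p9 :
    (∀ k : ℕ, 0 < rankLimit k) ∧ HasSum rankLimit 1 ∧
    ∀ r : ℕ, 1 ≤ r →
      (∀ k : Fin r → ℕ, ∃ C : ℝ, ∀ n : ℕ, r ≤ n →
        ∃ ε : ℝ, |ε| ≤ C / (n : ℝ) ∧
          rankProb r n {k} = (1 + ε) * ∏ j : Fin r, rankLimit (k j)) ∧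
      (∀ S : Set (Fin r → ℕ),
        Tendsto (fun n : ℕ => rankProb r n S) atTop
          (𝓝 (∑' k : S, ∏ j : Fin r, rankLimit (k.1 j)))) := by
  rw [show rankLimit = rankDensity from funext rankLimit_eq]
  refine ⟨rankDensity_pos, hasSum_rankDensity, fun r hr => ⟨fun k => ?_, fun S => ?_⟩⟩
  · obtain ⟨C, -, hC⟩ := exists_abs_rankProb_sub_le r hr k
    have hp : 0 < ∏ j, rankDensity (k j) := Finset.prod_pos fun j _ => rankDensity_pos _
    -- Positivity of the limit turns the absolute error into a relative one.
    refine ⟨C / ∏ j, rankDensity (k j), fun n hn =>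
      ⟨rankProb r n {k} / (∏ j, rankDensity (k j)) - 1, ?_, ?_⟩⟩
    · have e : rankProb r n {k} / (∏ j, rankDensity (k j)) - 1 =
          (rankProb r n {k} - ∏ j, rankDensity (k j)) / ∏ j, rankDensity (k j) := by
        field_simp
      rw [e, abs_div, abs_of_pos hp, div_right_comm]
      exact div_le_div_of_nonneg_right (hC n hn) hp.le
    · field_simp
      ring
  · refine tendsto_prob_of_tendsto_singleton (P := rankProb r)
      (p := fun k : Fin r → ℕ => ∏ j, rankDensity (k j))
      (hasSum_pi_prod rankDensity_nonneg hasSum_rankDensity r) (fun k => ?_)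
      (fun n S K => sum_rankProb_singleton_le S K) ?_ S
    · obtain ⟨C, -, hC⟩ := exists_abs_rankProb_sub_le r hr k
      rw [tendsto_iff_norm_sub_tendsto_zero]
      refine squeeze_zero' (Eventually.of_forall fun n => norm_nonneg _) ?_
        (tendsto_const_div_atTop_nhds_zero_nat C)
      filter_upwards [eventually_ge_atTop r] with n hn
      exact hC n hn
    -- For n < r there are no samples and both probabilities are 0/0 = 0, so the total is 1 only
    -- from n = r on.
    · filter_upwards [eventually_ge_atTop r] with n hn S
      exact rankProb_add_compl hr hn S
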